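/- Let $S=\mathbb{C}[x_0,x_1,x_2,x_3]$ and $\mathbb{P}^3=\operatorname{Proj} S$. A curve is a one-dimensional closed subscheme $C\subset\mathbb{P}^3$ (possibly singular, reducible or non-reduced), with ideal sheaf $\mathscr{I}_C$ and homogeneous (saturated) ideal $I(C)=\bigoplus_{n} H^0(\mathbb{P}^3,\mathscr{I}_C(n))\subset S$. It is called ACM (arithmetically Cohen–Macaulay) if its homogeneous coordinate ring $S/I(C)$ is a Cohen–Macaulay ring, and a complete intersection if $I(C)$ is generated by a regular sequence of two forms. Let $Q=V(F)\subset\mathbb{P}^3$ be a smooth quadric surface and let $C\subseteq Q$ be a curve (contained in $Q$ as a scheme, i.e. $F\in I(C)$). Then $C$ is ACM if and only if one of the following conditions holds: 1. $C$ is a complete intersection; or 2. there is an integer $k\ge 1$ such that $C$ has a minimal free resolution $$0\to \mathcal{O}_{\mathbb{P}^3}(-(2+k))^{2}\to \mathcal{O}_{\mathbb{P}^3}(-(1+k))^{2}\oplus \mathcal{O}_{\mathbb{P}^3}(-2)\to \mathscr{I}_C\to 0,$$ that is, the minimal graded free resolution of $I(C)$ over $S$ has the form $$0\to S(-(2+k))^{2}\to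 S(-(1+k))^{2}\oplus S(-2)\to I(C)\to 0 .$$ -/

import Mathlib

open AlgebraicGeometry CategoryTheory RingTheory.Sequence

noncomputable section

namespace SpaceCurves

/-- The homogeneous coordinate ring `ℂ[x₀, x₁, x₂, x₃]` of `ℙ³`. -/
abbrev S : Type := MvPolynomial (Fin 4) ℂ

/-- The standard grading of `S`: the `n`-th piece consists of the forms of degree `n`. -/
abbrev gradS : ℕ → Submodule ℂ S := MvPolynomial.homogeneousSubmodule (Fin 4) ℂ

instance : GradedAlgebra gradS := MvPolynomial.gradedAlgebra

/-- Complex projective three-space, as a scheme. -/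
abbrev P3 : Scheme := Proj gradS

/-- The standard affine chart `D₊(xᵢ)` of `ℙ³`. -/
abbrev chart (i : Fin 4) : P3.Opens := Proj.basicOpen gradS (MvPolynomial.X i)

/-- For a form `f` of degree `n`, the regular function `f / xᵢⁿ` on the chart `D₊(xᵢ)`. -/
def dehomogenize (i : Fin 4) (n : ℕ) (f : S) (hf : f ∈ gradS n) : Γ(P3, chart i) :=
  Proj.awayToSection gradS (MvPolynomial.X i)
    (HomogeneousLocalization.Away.mk gradS
      (show (MvPolynomial.X i : S) ∈ gradS 1 from MvPolynomial.isHomogeneous_X ℂ i) n f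
      (by simpa using hf))

/-- The homogeneous (saturated) ideal `I(C) = ⨁ₙ H⁰(ℙ³, 𝓘_C(n))` of a closed subscheme
`ι : C ⟶ ℙ³`: it is generated by the forms `f` that vanish on `C`, that is, forms `f` of some
degree `n` such that `f / xᵢⁿ` restricts to zero on `C ∩ D₊(xᵢ)` for every `i`. -/
def homogeneousIdeal {C : Scheme} (ι : C ⟶ P3) : Ideal S :=
  Ideal.span {f | ∃ (n : ℕ) (hf : f ∈ gradS n), ∀ i : Fin 4,
    ι.app (chart i) (dehomogenize i n f hf) = 0}

/-- `ι : C ⟶ ℙ³` is a curve: a one-dimensional closed subscheme of `ℙ³`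
(it may be singular, reducible or non-reduced). -/
structure IsCurve {C : Scheme} (ι : C ⟶ P3) : Prop where
  isClosedImmersion : IsClosedImmersion ι
  dim_eq_one : topologicalKrullDim C = 1

/-- The depth (grade) of an ideal `P` on the ring `R`: the supremum of the lengths of the
`R`-regular sequences contained in `P`. -/
def depth {R : Type*} [CommRing R] (P : Ideal R) : ℕ∞ :=
  ⨆ rs : {rs : List R // IsRegular R rs ∧ ∀ r ∈ rs, r ∈ P}, (rs.1.length : ℕ∞)

/-- A Cohen–Macaulay ring: a Noetherian ring in which every maximal ideal has depth equal to
its height. -/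
def IsCohenMacaulay (R : Type*) [CommRing R] : Prop :=
  IsNoetherianRing R ∧ ∀ P : Ideal R, P.IsMaximal → depth P = P.height

/-- `C` is arithmetically Cohen–Macaulay: its homogeneous coordinate ring is Cohen–Macaulay. -/
def IsACM {C : Scheme} (ι : C ⟶ P3) : Prop :=
  IsCohenMacaulay (S ⧸ homogeneousIdeal ι)

/-- `C` is the complete intersection of two surfaces: its homogeneous ideal is generated by a
regular sequence of two forms. -/
def IsCompleteIntersection {C : Scheme} (ι : C ⟶ P3) : Prop :=
  ∃ (G H : S) (d e : ℕ), G.IsHomogeneous d ∧ H.IsHomogeneous e ∧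
    IsRegular S [G, H] ∧ homogeneousIdeal ι = Ideal.span {G, H}

/-- An element `v` of the graded free module `⨁ᵢ S(-aᵢ)` is homogeneous of degree `d`:
as `S(-a)_d = S_{d-a}`, its `i`-th coordinate is a form of degree `d - aᵢ`, and it is zero
where `d < aᵢ`. -/
def IsHomogeneousElt {n : ℕ} (a : Fin n → ℕ) (d : ℕ) (v : Fin n → S) : Prop :=
  ∀ i, (∃ e : ℕ, e + a i = d ∧ (v i).IsHomogeneous e) ∨ v i = 0

/-- The ideal `I` has a minimal graded free resolution
`0 → ⨁ⱼ S(-bⱼ) → ⨁ᵢ S(-aᵢ) → I → 0`: the maps are graded of degree zero, the sequence is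
exact, and it is minimal in that the image of the first map lies in
`(x₀, x₁, x₂, x₃) · ⨁ᵢ S(-aᵢ)`. -/
def HasMinimalFreeResolution (I : Ideal S) {m n : ℕ} (b : Fin m → ℕ) (a : Fin n → ℕ) : Prop :=
  ∃ (φ : (Fin m → S) →ₗ[S] (Fin n → S)) (ψ : (Fin n → S) →ₗ[S] S),
    (∀ d v, IsHomogeneousElt b d v → IsHomogeneousElt a d (φ v)) ∧
    (∀ d v, IsHomogeneousElt a d v → (ψ v).IsHomogeneous d) ∧
    Function.Injective φ ∧
    Function.Exact φ ψ ∧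
    LinearMap.range ψ = I ∧
    ∀ v i, φ v i ∈ Ideal.span (Set.range (MvPolynomial.X : Fin 4 → S))

/-- The surface `V(F) ⊆ ℙ³` is a smooth quadric: `F` is a form of degree two, and `F` and its
partial derivatives have no common zero in `ℙ³`. -/
structure IsSmoothQuadric (F : S) : Prop where
  isHomogeneous : F.IsHomogeneous 2
  smooth : ∀ p : Fin 4 → ℂ, p ≠ 0 → MvPolynomial.eval p F = 0 →
    ∃ i, MvPolynomial.eval p (MvPolynomial.pderiv i F) ≠ 0

/-- The closed subscheme `C` is contained, as a scheme, in the surface `V(F)`, that is, the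
form `F` vanishes on `C`. -/
def IsContainedIn {C : Scheme} (ι : C ⟶ P3) (F : S) : Prop :=
  F ∈ homogeneousIdeal ι

end SpaceCurves

end

open AlgebraicGeometry CategoryTheory RingTheory.Sequence

noncomputable section

namespace SpaceCurves

/-! ### Regular sequences, depth and height -/

/-! Write `I` for the homogeneous ideal of the curve. The irrelevant ideal of `S ⧸ I` has height at
least 2 (`two_le_height`), so if `C` is ACM it contains a regular pair. Fix a point `p` off the
quadric. Projection from `p` makes the quadric a double cover of a plane, and prime avoidance inside
the space of linear forms vanishing at `p` replaces the pair by two such forms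
(`exists_regular_linearForms`). In suitable coordinates these forms are `X₁, X₂` and, up to a
scalar, `F = X₀² - p'X₀ - q'` with `p', q'` in `T = ℂ[X₁, X₂, X₃]`.

Now `S/(F)` is free over `T` on `1, X₀`, and `I/(F)` becomes a graded submodule `M` of `T × T` whose
quotient has `X₁, X₂` as a weakly regular sequence. A graded Nakayama argument gives generators `e₁,
e₂` of `M` in degrees `m₁ ≤ m₂` (`IsGradedDeep.exists_generates`). Everything is then read off from
the action of `X₀`. Write `X₀e₁ = s₁e₁ + t₁e₂`. If `t₁e₂ = 0`, then `s₁` is a linear root of the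
quadric and `F` is a product of two linear forms, contradicting smoothness; so `m₂ ≤ m₁ + 1`. If `m₂
= m₁ + 1`, then `t₁` is a nonzero constant, `e₂` is redundant, and `I` is generated by `F` and one
more form. If `m₂ = m₁ = k`, then `X₀` acts by a matrix `W` of linear forms, and `X₀ - W` presents
`I/(F)`; lifting its columns to relations in `S` gives the Hilbert–Burch resolution when `k ≥ 1`.
For `k = 0` the ideal is generated by two linear forms, again a complete intersection.

Conversely, both alternatives give an exact sequence `0 → Sᵐ → Sⁿ → I → 0`. Comparing it with the
Koszul complex at a maximal ideal `(Xᵢ - aᵢ)` forces depth at least 2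
(`isCohenMacaulay_of_resolution`). Dimension at most 2 follows because `F` is prime and `I ≠ (F)`: a
quadric contains a line, so it has a chain of points too long for a curve. -/

theorem isSMulRegular_iff_mul_eq_zero {R : Type*} [CommRing R] {f : R} :
    IsSMulRegular R f ↔ ∀ x, f * x = 0 → x = 0 := by
  rw [isSMulRegular_iff_right_eq_zero_of_smul]; rfl

theorem isSMulRegular_quotSMulTop_iff {R : Type*} [CommRing R] {f g : R} :
    IsSMulRegular (QuotSMulTop f R) g ↔ ∀ x, f ∣ g * x → f ∣ x := by
  rw [isSMulRegular_quotient_iff_mem_of_smul_mem]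
  simp [← Submodule.ideal_span_singleton_smul, Ideal.mem_span_singleton]

theorem isRegular_pair_iff {R : Type*} [CommRing R] {f g : R} :
    IsRegular R [f, g] ↔ (∀ x, f * x = 0 → x = 0) ∧ (∀ x, f ∣ g * x → f ∣ x) ∧
      Ideal.span {f, g} ≠ ⊤ := by
  rw [isRegular_iff, isWeaklyRegular_cons_iff, isWeaklyRegular_singleton_iff,
    isSMulRegular_iff_mul_eq_zero, isSMulRegular_quotSMulTop_iff, and_assoc]
  simp [Ideal.ofList, ne_comm, Set.insert_def]

/-- A regular sequence inside `P` stays regular in the localization at `P`, where each member lowers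
the dimension by one; the quotient is nonzero, so its dimension is nonnegative. -/
theorem length_le_height {R : Type*} [CommRing R] [IsNoetherianRing R] (P : Ideal R) [P.IsPrime]
    {rs : List R} (hrs : IsRegular R rs) (hP : ∀ r ∈ rs, r ∈ P) : (rs.length : ℕ∞) ≤ P.height := by
  have h := hrs.toIsWeaklyRegular.isRegular_of_isLocalization_of_mem (Localization.AtPrime P) P hP
  have h1 := ringKrullDim_add_length_eq_ringKrullDim_of_isRegular _ h
  rw [IsLocalization.AtPrime.ringKrullDim_eq_height P (Localization.AtPrime P),
    List.length_map] at h1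
  have h2 : Nontrivial (Localization.AtPrime P ⧸
      Ideal.ofList (rs.map (algebraMap R (Localization.AtPrime P)))) := by
    rw [Ideal.Quotient.nontrivial_iff]
    simpa using h.top_ne_smul.symm
  rw [← WithBot.coe_le_coe, ← h1]
  calc ((rs.length : ℕ∞) : WithBot ℕ∞) = 0 + (rs.length : WithBot ℕ∞) := by rw [zero_add]; rfl
    _ ≤ _ := by gcongr; exact ringKrullDim_nonneg_of_nontrivial

theorem depth_le_height {R : Type*} [CommRing R] [IsNoetherianRing R] (P : Ideal R) [P.IsPrime] :
    depth P ≤ P.height :=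
  iSup_le fun rs => length_le_height P rs.2.1 rs.2.2

/-- Prime avoidance: a maximal ideal which is not associated to `M` contains an `M`-regular
element. -/
theorem exists_isSMulRegular_of_isMaximal {R M : Type*} [CommRing R] [IsNoetherianRing R]
    [AddCommGroup M] [Module R M] [Module.Finite R M] (P : Ideal R) [P.IsMaximal]
    (h : ∀ x : M, (∀ z ∈ P, z • x = 0) → x = 0) : ∃ y ∈ P, IsSMulRegular M y := by
  by_contra! hc
  have hsub : (P : Set R) ⊆ ⋃ p ∈ associatedPrimes R M, (p : Set R) := by
    rw [biUnion_associatedPrimes_eq_compl_regular]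
    exact fun y hy => hc y hy
  obtain ⟨q, hq, hPq⟩ := (Ideal.subset_union_prime_finite (associatedPrimes.finite R M) (f := id)
    ⊤ ⊤ fun q hq _ _ => hq.1).1 hsub
  obtain ⟨hq1, x, hx⟩ := isAssociatedPrime_iff.1 hq
  obtain rfl : P = q := Ideal.IsMaximal.eq_of_le ‹_› hq1.ne_top hPq
  have hx0 : x = 0 := h x fun z hz => by
    rw [hx] at hz
    simpa [Submodule.mem_colon] using hz
  apply hq1.ne_top
  rw [hx, hx0]
  simp [Submodule.colon]

/-- The hypotheses `h0` and `h1` say that Koszul cohomology vanishes in degrees 0 and 1. Prime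
avoidance gives `y₁`. If `P` kills `x` modulo `y₁`, the quotients `zᵢx / y₁` form a 1-cocycle, hence
equal `zᵢs`, and so `x = y₁s`; thus prime avoidance applies again modulo `y₁`. -/
theorem exists_isRegular_pair {R ι : Type*} [CommRing R] [IsNoetherianRing R] (P : Ideal R)
    [hP : P.IsMaximal] (z : ι → R) (hz : P = Ideal.span (Set.range z))
    (h0 : ∀ x, (∀ i, z i * x = 0) → x = 0)
    (h1 : ∀ t : ι → R, (∀ i j, z j * t i = z i * t j) → ∃ s, ∀ i, t i = z i * s) :
    ∃ y₁ ∈ P, ∃ y₂ ∈ P, IsRegular R [y₁, y₂] := by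
  have hzP : ∀ i, z i ∈ P := fun i => hz ▸ Ideal.subset_span ⟨i, rfl⟩
  obtain ⟨y₁, hy₁, hr₁⟩ := exists_isSMulRegular_of_isMaximal (M := R) P
    fun x hx => h0 x fun i => hx _ (hzP i)
  obtain ⟨y₂, hy₂, hr₂⟩ := exists_isSMulRegular_of_isMaximal (M := QuotSMulTop y₁ R) P (by
    intro x hx
    obtain ⟨x, rfl⟩ := Submodule.Quotient.mk_surjective _ x
    have hdvd : ∀ i, y₁ ∣ z i * x := fun i => by
      have := hx _ (hzP i)
      rw [← Submodule.Quotient.mk_smul, Submodule.Quotient.mk_eq_zero] at this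
      simpa [← Submodule.ideal_span_singleton_smul, Ideal.mem_span_singleton] using this
    choose t ht using hdvd
    rw [isSMulRegular_iff_mul_eq_zero] at hr₁
    obtain ⟨s, hs⟩ := h1 t fun i j => by
      rw [← sub_eq_zero]
      apply hr₁
      linear_combination z i * ht j - z j * ht i
    have : x = y₁ * s := by
      rw [← sub_eq_zero]
      apply h0
      intro i
      linear_combination ht i + y₁ * hs i
    rw [Submodule.Quotient.mk_eq_zero]
    simp [← Submodule.ideal_span_singleton_smul, Ideal.mem_span_singleton, this])
  refine ⟨y₁, hy₁, y₂, hy₂, isRegular_pair_iff.2 ⟨isSMulRegular_iff_mul_eq_zero.1 hr₁,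
    isSMulRegular_quotSMulTop_iff.1 hr₂, fun h => hP.ne_top ?_⟩⟩
  rw [eq_top_iff, ← h, Ideal.span_le]
  rintro _ (rfl | rfl) <;> assumption

/-! ### Exactness of the Koszul complex of four elements -/

/-- The elements `z 0, …, z 3` form a weakly regular sequence on `M`. -/
structure KoszulRegular {A : Type*} (M : Type*) [CommRing A] [AddCommGroup M] [Module A M]
    (z : Fin 4 → A) : Prop where
  reg0 : ∀ x : M, z 0 • x = 0 → x = 0
  reg1 : ∀ x y : M, z 1 • x = z 0 • y → ∃ c, x = z 0 • c
  reg2 : ∀ x y y' : M, z 2 • x = z 0 • y + z 1 • y' → ∃ c c', x = z 0 • c + z 1 • c'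
  reg3 : ∀ x y y' y'' : M, z 3 • x = z 0 • y + z 1 • y' + z 2 • y'' →
    ∃ c c' c'', x = z 0 • c + z 1 • c' + z 2 • c''

namespace KoszulRegular

variable {A M : Type*} [CommRing A] [AddCommGroup M] [Module A M] {z : Fin 4 → A}

theorem eq_of_smul_eq (hz : KoszulRegular M z) {x y : M} (h : z 0 • x = z 0 • y) : x = y := by
  rw [← sub_eq_zero]
  exact hz.reg0 _ (by rw [smul_sub, h, sub_self])

/-- The complex is `M → M⁴ → M⁶ → M⁴ → M`, and the first number in a name is the degree where it is
exact; the suffix `_three` marks the complex of `z 0, z 1, z 2`. In degrees one and two, only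
cocycle relations involving the index 0 are assumed, since `z 0` is a nonzerodivisor. -/
theorem exact_one (hz : KoszulRegular M z) (t : Fin 4 → M)
    (h : ∀ i, z i • t 0 = z 0 • t i) : ∃ s, ∀ i, t i = z i • s := by
  obtain ⟨s, hs⟩ := hz.reg1 _ _ (h 1)
  refine ⟨s, fun i => hz.eq_of_smul_eq ?_⟩
  rw [← h i, hs, smul_comm]

theorem exact_one_three (hz : KoszulRegular M z) (t0 t1 t2 : M) (h1 : z 1 • t0 = z 0 • t1)
    (h2 : z 2 • t0 = z 0 • t2) : ∃ s, t0 = z 0 • s ∧ t1 = z 1 • s ∧ t2 = z 2 • s := by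
  obtain ⟨s, rfl⟩ := hz.reg1 _ _ h1
  exact ⟨s, rfl, hz.eq_of_smul_eq (by rw [← h1, smul_comm]),
    hz.eq_of_smul_eq (by rw [← h2, smul_comm])⟩

theorem exact_two_three (hz : KoszulRegular M z) (u01 u02 u12 : M)
    (h : z 2 • u01 - z 1 • u02 + z 0 • u12 = 0) : ∃ q0 q1 q2 : M,
      u01 = z 1 • q0 - z 0 • q1 ∧ u02 = z 2 • q0 - z 0 • q2 ∧ u12 = z 2 • q1 - z 1 • q2 := by
  obtain ⟨c, c', hc⟩ := hz.reg2 u01 (-u12) u02 (by rw [← sub_eq_zero, ← h]; module)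
  obtain ⟨d, hd⟩ := hz.reg1 (u02 - z 2 • c') (u12 + z 2 • c) (by
    rw [← sub_eq_zero]
    trans -(z 2 • u01 - z 1 • u02 + z 0 • u12)
    · rw [hc]; module
    · rw [h, neg_zero])
  refine ⟨c', -c, -d, ?_, ?_, hz.eq_of_smul_eq ?_⟩
  · rw [hc]; module
  · rw [sub_eq_iff_eq_add.1 hd]; module
  · have h' : z 0 • u12 = z 1 • u02 - z 2 • u01 := by rw [← sub_eq_zero, ← h]; module
    rw [h', hc, sub_eq_iff_eq_add.1 hd]; module

theorem exact_two (hz : KoszulRegular M z) (u01 u02 u03 u12 u13 u23 : M)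
    (h3 : z 2 • u01 - z 1 • u02 + z 0 • u12 = 0) (h2 : z 3 • u01 - z 1 • u03 + z 0 • u13 = 0)
    (h1 : z 3 • u02 - z 2 • u03 + z 0 • u23 = 0) : ∃ q0 q1 q2 q3 : M,
      u01 = z 1 • q0 - z 0 • q1 ∧ u02 = z 2 • q0 - z 0 • q2 ∧ u12 = z 2 • q1 - z 1 • q2 ∧
      u03 = z 3 • q0 - z 0 • q3 ∧ u13 = z 3 • q1 - z 1 • q3 ∧ u23 = z 3 • q2 - z 2 • q3 := by
  obtain ⟨q0, q1, q2, rfl, rfl, rfl⟩ := hz.exact_two_three u01 u02 u12 h3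
  obtain ⟨d, hd⟩ := hz.reg1 (u03 - z 3 • q0) (u13 - z 3 • q1) (by
    rw [← sub_eq_zero, ← neg_eq_zero, ← h2]; module)
  rw [sub_eq_iff_eq_add] at hd
  subst hd
  refine ⟨q0, q1, q2, -d, rfl, rfl, rfl, by module, hz.eq_of_smul_eq ?_, hz.eq_of_smul_eq ?_⟩
  · rw [← sub_eq_zero, ← h2]; module
  · rw [← sub_eq_zero, ← h1]; module

theorem exact_three (hz : KoszulRegular M z) (w012 w013 w023 w123 : M)
    (h : z 3 • w012 - z 2 • w013 + z 1 • w023 - z 0 • w123 = 0) :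
    ∃ v01 v02 v03 v12 v13 v23 : M,
      w012 = z 2 • v01 - z 1 • v02 + z 0 • v12 ∧ w013 = z 3 • v01 - z 1 • v03 + z 0 • v13 ∧
      w023 = z 3 • v02 - z 2 • v03 + z 0 • v23 ∧ w123 = z 3 • v12 - z 2 • v13 + z 1 • v23 := by
  obtain ⟨c, c', c'', rfl⟩ := hz.reg3 w012 w123 (-w023) w013 (by
    rw [← sub_eq_zero, ← h]; module)
  obtain ⟨q0, q1, q2, h01, h02, h12⟩ := hz.exact_two_three (w013 - z 3 • c'') (w023 + z 3 • c')
    (w123 - z 3 • c) (by rw [← neg_eq_zero, ← h]; module)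
  refine ⟨c'', -c', -q0, c, -q1, -q2, by module, ?_, ?_, ?_⟩
  · rw [sub_eq_iff_eq_add.1 h01]; module
  · rw [← sub_eq_zero, ← sub_eq_zero.2 h02]; module
  · rw [sub_eq_iff_eq_add.1 h12]; module

theorem pi {ι : Type*} (hz : KoszulRegular A z) : KoszulRegular (ι → A) z where
  reg0 x h := funext fun i => hz.reg0 _ (congrFun h i)
  reg1 x y h := by
    choose c hc using fun i => hz.reg1 (x i) (y i) (congrFun h i)
    exact ⟨c, funext hc⟩
  reg2 x y y' h := by
    choose c c' hc using fun i => hz.reg2 (x i) (y i) (y' i) (congrFun h i)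
    exact ⟨c, c', funext hc⟩
  reg3 x y y' y'' h := by
    choose c c' c'' hc using fun i => hz.reg3 (x i) (y i) (y' i) (y'' i) (congrFun h i)
    exact ⟨c, c', c'', funext hc⟩

end KoszulRegular

/-- Two algebra maps into the quotient by `J` agree as soon as they agree on the variables. -/
theorem sub_aeval_mem {σ R : Type*} [CommRing R] (J : Ideal (MvPolynomial σ R))
    (g : σ → MvPolynomial σ R) (hg : ∀ i, MvPolynomial.X i - g i ∈ J) (f : MvPolynomial σ R) :
    f - MvPolynomial.aeval g f ∈ J := by
  rw [← Ideal.Quotient.eq]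
  have : (Ideal.Quotient.mkₐ R J) = (Ideal.Quotient.mkₐ R J).comp (MvPolynomial.aeval g) := by
    ext i
    simpa [Ideal.Quotient.eq] using hg i
  exact DFunLike.congr_fun this f

/-- Modulo those of the elements `Xᵢ - aᵢ` with `i ∈ s`, the element `Xₖ - aₖ` with `k ∉ s` is a
nonzerodivisor. -/
theorem mem_span_image_of_X_sub_C_mul_mem {σ R : Type*} [CommRing R] [IsDomain R] (a : σ → R)
    (s : Set σ) {k : σ} (hk : k ∉ s) (f : MvPolynomial σ R)
    (h : (MvPolynomial.X k - MvPolynomial.C (a k)) * f ∈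
      Ideal.span ((fun i => MvPolynomial.X i - MvPolynomial.C (a i)) '' s)) :
    f ∈ Ideal.span ((fun i => MvPolynomial.X i - MvPolynomial.C (a i)) '' s) := by
  classical
  set J := Ideal.span ((fun i => (MvPolynomial.X i - MvPolynomial.C (a i) :
    MvPolynomial σ R)) '' s)
  set g : σ → MvPolynomial σ R := fun i => if i ∈ s then .C (a i) else .X i
  have hg : ∀ f, f - MvPolynomial.aeval g f ∈ J := sub_aeval_mem J g fun i => by
    by_cases hi : i ∈ s
    · simpa [g, hi] using (Ideal.subset_span ⟨i, hi, rfl⟩ : _ ∈ J)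
    · simp [g, hi]
  have hJ : J ≤ RingHom.ker (MvPolynomial.aeval (R := R) g) := by
    rw [Ideal.span_le]
    rintro _ ⟨i, hi, rfl⟩
    simp [g, hi, RingHom.mem_ker, MvPolynomial.algebraMap_eq]
  have h0 := hJ h
  rw [RingHom.mem_ker, map_mul, map_sub, MvPolynomial.aeval_X, MvPolynomial.aeval_C] at h0
  have hne : (MvPolynomial.X k - MvPolynomial.C (a k) : MvPolynomial σ R) ≠ 0 := by
    intro h
    have := congrArg (MvPolynomial.coeff (Finsupp.single k 1)) h
    simp [MvPolynomial.coeff_C, eq_comm] at this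
  simp only [g, hk, if_false, MvPolynomial.algebraMap_eq] at h0
  have := hg f
  rwa [(mul_eq_zero.1 h0).resolve_left hne, sub_zero] at this

theorem koszulRegular_X_sub_C (a : Fin 4 → ℂ) :
    KoszulRegular S fun i => (MvPolynomial.X i - MvPolynomial.C (a i) : S) where
  reg0 x h := by
    have := mem_span_image_of_X_sub_C_mul_mem a ∅ (k := 0) (by simp) x (by simpa using h)
    simpa using this
  reg1 x y h := by
    have := mem_span_image_of_X_sub_C_mul_mem a {0} (k := 1) (by simp) x
      (by simpa [Ideal.mem_span_singleton] using ⟨y, h⟩)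
    rw [Set.image_singleton, Ideal.mem_span_singleton] at this
    exact this
  reg2 x y y' h := by
    have := mem_span_image_of_X_sub_C_mul_mem a {0, 1} (k := 2) (by simp) x (by
      rw [Set.image_pair, Ideal.mem_span_pair]
      exact ⟨y, y', by simp only [smul_eq_mul] at h; linear_combination -h⟩)
    rw [Set.image_pair, Ideal.mem_span_pair] at this
    obtain ⟨c, c', h⟩ := this
    exact ⟨c, c', by simp only [smul_eq_mul]; linear_combination -h⟩
  reg3 x y y' y'' h := by
    have := mem_span_image_of_X_sub_C_mul_mem a {0, 1, 2} (k := 3) (by simp) x (by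
      rw [Set.image_insert_eq, Set.image_pair, Ideal.mem_span_insert]
      exact ⟨y, _, Ideal.mem_span_pair.2 ⟨y', y'', rfl⟩, by
        simp only [smul_eq_mul] at h; linear_combination h⟩)
    rw [Set.image_insert_eq, Set.image_pair, Ideal.mem_span_insert] at this
    obtain ⟨c, w, hw, h⟩ := this
    obtain ⟨c', c'', rfl⟩ := Ideal.mem_span_pair.1 hw
    exact ⟨c, c', c'', by simp only [smul_eq_mul]; linear_combination h⟩

/-! ### Quotients with a free resolution of length two are Cohen–Macaulay in dimension two -/

section Resolution

variable {A ι κ : Type*} [CommRing A] {z : Fin 4 → A} {φ : (ι → A) →ₗ[A] (κ → A)}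
  {ψ : (κ → A) →ₗ[A] A}

/-- Dimension shifting: degree 0 Koszul cohomology of the cokernel of `ψ` comes from degree 2
cohomology of the free module on `ι`, which vanishes. Lift `zᵢs` to `uᵢ`, lift the commutators of
the `uᵢ` through `φ` to a 2-cocycle, and use its primitive to correct the `uᵢ` into a 1-cocycle
`zᵢt`; then `ψ t = s`. Three of the four elements suffice. -/
theorem mem_range_of_forall_mul_mem (hz : KoszulRegular A z) (hφ : Function.Injective φ)
    (hex : Function.Exact φ ψ) (s : A) (h : ∀ i, z i * s ∈ LinearMap.range ψ) :
    s ∈ LinearMap.range ψ := by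
  choose u hu using h
  have key : ∀ i j, ∃ w, φ w = z j • u i - z i • u j := fun i j => (hex _).1 (by
    simp only [map_sub, map_smul, hu, smul_eq_mul]; ring)
  obtain ⟨w01, h01⟩ := key 0 1
  obtain ⟨w02, h02⟩ := key 0 2
  obtain ⟨w12, h12⟩ := key 1 2
  obtain ⟨q0, q1, q2, rfl, rfl, rfl⟩ := (hz.pi (ι := ι)).exact_two_three w01 w02 w12 (hφ (by
    simp only [map_sub, map_add, map_smul, h01, h02, h12, map_zero]; module))
  simp only [map_sub, map_smul] at h01 h02 h12
  obtain ⟨t, ht, -, -⟩ := (hz.pi (ι := κ)).exact_one_three (u 0 - φ q0) (u 1 - φ q1) (u 2 - φ q2)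
    (by rw [← sub_eq_zero, ← sub_eq_zero.2 h01.symm]; module)
    (by rw [← sub_eq_zero, ← sub_eq_zero.2 h02.symm]; module)
  refine ⟨t, hz.eq_of_smul_eq ?_⟩
  have := congrArg ψ ht
  rw [map_sub, hu, hex.apply_apply_eq_zero, sub_zero, map_smul] at this
  exact this.symm

/-- The same chase one degree higher: degree 1 cohomology of the cokernel comes from degree 3
cohomology of the free module on `ι`, so all four elements are needed. -/
theorem exists_of_forall_mul_sub_mul_mem (hz : KoszulRegular A z) (hφ : Function.Injective φ)
    (hex : Function.Exact φ ψ) (t : Fin 4 → A)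
    (h : ∀ i j, z j * t i - z i * t j ∈ LinearMap.range ψ) :
    ∃ s, ∀ i, t i - z i * s ∈ LinearMap.range ψ := by
  choose u hu using h
  have key : ∀ i j k, ∃ w, φ w = z k • u i j - z j • u i k + z i • u j k :=
    fun i j k => (hex _).1 (by
      simp only [map_sub, map_add, map_smul, hu, smul_eq_mul]; ring)
  obtain ⟨w012, h012⟩ := key 0 1 2
  obtain ⟨w013, h013⟩ := key 0 1 3
  obtain ⟨w023, h023⟩ := key 0 2 3
  obtain ⟨w123, h123⟩ := key 1 2 3
  obtain ⟨v01, v02, v03, v12, v13, v23, rfl, rfl, rfl, rfl⟩ :=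
    (hz.pi (ι := ι)).exact_three w012 w013 w023 w123 (hφ (by
      simp only [map_sub, map_add, map_smul, h012, h013, h023, h123, map_zero]; module))
  simp only [map_sub, map_add, map_smul] at h012 h013 h023 h123
  obtain ⟨q0, q1, q2, q3, k01, k02, -, k03, -, -⟩ := (hz.pi (ι := κ)).exact_two
    (u 0 1 - φ v01) (u 0 2 - φ v02) (u 0 3 - φ v03) (u 1 2 - φ v12) (u 1 3 - φ v13) (u 2 3 - φ v23)
    (by rw [← neg_eq_zero, ← sub_eq_zero.2 h012]; module)
    (by rw [← neg_eq_zero, ← sub_eq_zero.2 h013]; module)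
    (by rw [← neg_eq_zero, ← sub_eq_zero.2 h023]; module)
  have e : ∀ (v : ι → A) (x : κ → A), ψ (x - φ v) = ψ x := fun v x => by
    rw [map_sub, hex.apply_apply_eq_zero, sub_zero]
  have k01' := congrArg ψ k01
  have k02' := congrArg ψ k02
  have k03' := congrArg ψ k03
  rw [e, hu, map_sub, map_smul, map_smul] at k01' k02' k03'
  let q : Fin 4 → (κ → A) := ![q0, q1, q2, q3]
  obtain ⟨s, hs⟩ := hz.exact_one (fun i => t i - ψ (q i)) (by
    intro i
    simp only [smul_eq_mul] at k01' k02' k03' ⊢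
    fin_cases i
    · rfl
    · show z 1 * (t 0 - ψ q0) = z 0 * (t 1 - ψ q1); linear_combination k01'
    · show z 2 * (t 0 - ψ q0) = z 0 * (t 2 - ψ q2); linear_combination k02'
    · show z 3 * (t 0 - ψ q0) = z 0 * (t 3 - ψ q3); linear_combination k03')
  exact ⟨s, fun i => ⟨q i, by have := hs i; simp only [smul_eq_mul] at this; linear_combination -this⟩⟩

end Resolution

/-- The Nullstellensatz: a maximal ideal is the vanishing ideal of a point `a`, and modulo the `Xᵢ -
aᵢ` a polynomial is its value at `a`. -/
theorem exists_eq_span_X_sub_C (P : Ideal S) [P.IsMaximal] : ∃ a : Fin 4 → ℂ,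
    P = Ideal.span (Set.range fun i => (MvPolynomial.X i - MvPolynomial.C (a i) : S)) := by
  obtain ⟨a, rfl⟩ := MvPolynomial.isMaximal_iff_eq_vanishingIdeal_singleton.1 ‹P.IsMaximal›
  refine ⟨a, le_antisymm (fun f hf => ?_) ?_⟩
  · have := sub_aeval_mem (Ideal.span (Set.range fun i =>
      (MvPolynomial.X i - MvPolynomial.C (a i) : S))) (fun i => MvPolynomial.C (a i))
      (fun i => Ideal.subset_span ⟨i, rfl⟩) f
    have h0 : MvPolynomial.aeval (fun i => (MvPolynomial.C (a i) : S)) f = 0 := by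
      have h1 := (MvPolynomial.mem_vanishingIdeal_singleton_iff a f).1 hf
      rw [show (fun i => (MvPolynomial.C (a i) : S)) = algebraMap ℂ S ∘ a from rfl,
        MvPolynomial.aeval_algebraMap_apply, h1, map_zero]
    rwa [h0, sub_zero] at this
  · rw [Ideal.span_le]
    rintro _ ⟨i, rfl⟩
    simp

/-- The resolution gives `2 ≤ depth P` at every maximal ideal, and `depth P ≤ height P ≤ dim ≤ 2`
closes the circle. No grading is needed. -/
theorem isCohenMacaulay_of_resolution {ι κ : Type*} {φ : (ι → S) →ₗ[S] (κ → S)}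
    {ψ : (κ → S) →ₗ[S] S} (hφ : Function.Injective φ) (hex : Function.Exact φ ψ) {I : Ideal S}
    (hI : LinearMap.range ψ = I) (hdim : ringKrullDim (S ⧸ I) ≤ 2) :
    IsCohenMacaulay (S ⧸ I) := by
  refine ⟨inferInstance, fun P hP => le_antisymm (depth_le_height P) ?_⟩
  have hmax := Ideal.comap_isMaximal_of_surjective (Ideal.Quotient.mk I)
    Ideal.Quotient.mk_surjective (K := P)
  obtain ⟨a, ha⟩ := exists_eq_span_X_sub_C (P.comap (Ideal.Quotient.mk I))
  set z : Fin 4 → S := fun i => MvPolynomial.X i - MvPolynomial.C (a i) with hz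
  have hPz : P = Ideal.span (Set.range fun i => Ideal.Quotient.mk I (z i)) := by
    rw [← Ideal.map_comap_of_surjective (Ideal.Quotient.mk I) Ideal.Quotient.mk_surjective P, ha,
      Ideal.map_span, ← Set.range_comp]
    rfl
  have hreg : KoszulRegular S z := koszulRegular_X_sub_C a
  obtain ⟨y₁, h₁, y₂, h₂, h⟩ := exists_isRegular_pair P _ hPz
    (by
      intro x hx
      obtain ⟨x, rfl⟩ := Ideal.Quotient.mk_surjective x
      rw [Ideal.Quotient.eq_zero_iff_mem, ← hI]
      refine mem_range_of_forall_mul_mem hreg hφ hex x fun i => ?_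
      rw [hI, ← Ideal.Quotient.eq_zero_iff_mem, map_mul, hx i])
    (by
      intro t ht
      choose t' ht' using fun i => Ideal.Quotient.mk_surjective (t i)
      obtain ⟨s, hs⟩ := exists_of_forall_mul_sub_mul_mem hreg hφ hex t' (by
        intro i j
        rw [hI, ← Ideal.Quotient.eq_zero_iff_mem, map_sub, map_mul, map_mul, ht', ht', ht i j,
          sub_self])
      refine ⟨Ideal.Quotient.mk I s, fun i => ?_⟩
      rw [← ht', ← map_mul, Ideal.Quotient.eq, ← hI]
      exact hs i)
  have hle : P.height ≤ 2 := by
    have := (Ideal.height_le_ringKrullDim_of_ne_top hP.ne_top).trans hdim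
    exact WithBot.coe_le_coe.1 this
  refine hle.trans ?_
  exact le_iSup (fun rs : {rs : List (S ⧸ I) // IsRegular (S ⧸ I) rs ∧ ∀ r ∈ rs, r ∈ P} =>
    (rs.1.length : ℕ∞)) ⟨[y₁, y₂], h, by simp [h₁, h₂]⟩

/-- The Koszul resolution of an ideal generated by a regular sequence of length two. -/
theorem exists_resolution_of_isRegular_pair {A : Type*} [CommRing A] {G H : A}
    (h : IsRegular A [G, H]) : ∃ (φ : (Fin 1 → A) →ₗ[A] (Fin 2 → A)) (ψ : (Fin 2 → A) →ₗ[A] A),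
      Function.Injective φ ∧ Function.Exact φ ψ ∧ LinearMap.range ψ = Ideal.span {G, H} := by
  obtain ⟨h1, h2, -⟩ := isRegular_pair_iff.1 h
  refine ⟨(LinearMap.proj 0).smulRight ![H, -G],
    G • LinearMap.proj 0 + H • LinearMap.proj 1, ?_, ?_, ?_⟩
  · rw [injective_iff_map_eq_zero]
    intro x hx
    have := congrFun hx 1
    simp at this
    ext i
    rw [Subsingleton.elim i 0]
    exact h1 _ (by linear_combination this)
  · intro x
    constructor
    · intro hx
      simp at hx
      obtain ⟨c, hc⟩ := h2 (x 1) ⟨-x 0, by linear_combination hx⟩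
      refine ⟨fun _ => -c, ?_⟩
      have h0 : x 0 = -c * H := by
        rw [← sub_eq_zero]
        apply h1
        rw [hc] at hx
        linear_combination hx
      ext i; fin_cases i
      · simp [h0]
      · simp [hc]; ring
    · rintro ⟨y, rfl⟩
      simp; ring
  · ext x
    rw [Ideal.mem_span_pair]
    constructor
    · rintro ⟨y, rfl⟩
      exact ⟨y 0, y 1, by simp; ring⟩
    · rintro ⟨a, b, rfl⟩
      exact ⟨![a, b], by simp; ring⟩

/-! ### The points of a closed subscheme of projective space -/

/-- The homogeneous prime ideal of a point of projective space. -/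
def pointIdeal (x : P3) : Ideal S :=
  (show ProjectiveSpectrum gradS from x).asHomogeneousIdeal.toIdeal

instance (x : P3) : (pointIdeal x).IsPrime :=
  (show ProjectiveSpectrum gradS from x).isPrime

theorem pointIdeal_isHomogeneous (x : P3) : (pointIdeal x).IsHomogeneous gradS :=
  (show ProjectiveSpectrum gradS from x).asHomogeneousIdeal.2

theorem isUnit_mapId_mk_iff (x : ProjectiveSpectrum gradS) (i : Fin 4) (n : ℕ) (f : S)
    (hf : f ∈ gradS (n • 1)) (hx : MvPolynomial.X i ∈ x.asHomogeneousIdeal.toIdeal.primeCompl) :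
    IsUnit (HomogeneousLocalization.mapId gradS (Submonoid.powers_le.mpr hx)
      (HomogeneousLocalization.Away.mk gradS
        (show (MvPolynomial.X i : S) ∈ gradS 1 from MvPolynomial.isHomogeneous_X ℂ i) n f hf)) ↔
      f ∉ x.asHomogeneousIdeal.toIdeal := by
  rw [← HomogeneousLocalization.isUnit_iff_isUnit_val]
  have hXn : (MvPolynomial.X i : S) ^ n ∈ x.asHomogeneousIdeal.toIdeal.primeCompl :=
    pow_mem hx n
  refine Iff.trans (iff_of_eq (congrArg IsUnit (?_ : _ = IsLocalization.mk'
    (Localization x.asHomogeneousIdeal.toIdeal.primeCompl) f ⟨_, hXn⟩)))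
    (IsLocalization.AtPrime.isUnit_mk'_iff _ x.asHomogeneousIdeal.toIdeal _ _)
  rw [← Localization.mk_eq_mk']
  rfl

/-- The bridge between sections of the structure sheaf and homogeneous primes: the stalk at `x` is
the homogeneous localization, where `f / xᵢⁿ` is a unit exactly when `f` avoids the prime of `x`. -/
theorem mem_basicOpen_dehomogenize (i : Fin 4) (n : ℕ) (f : S) (hf : f ∈ gradS n) (x : P3)
    (hx : x ∈ chart i) :
    x ∈ P3.basicOpen (dehomogenize i n f hf) ↔ f ∉ pointIdeal x := by
  rw [Scheme.mem_basicOpen _ _ _ hx]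
  set q := HomogeneousLocalization.Away.mk gradS
    (show (MvPolynomial.X i : S) ∈ gradS 1 from MvPolynomial.isHomogeneous_X ℂ i) n f
    (by simpa using hf) with hq
  have key : P3.presheaf.germ _ x hx (dehomogenize i n f hf) =
      (Proj.stalkIso' gradS x).symm
        (HomogeneousLocalization.mapId gradS (Submonoid.powers_le.mpr hx) q) := by
    have h := ProjectiveSpectrum.Proj.awayToSection_germ gradS (MvPolynomial.X i) x hx
    exact congrArg (fun φ => φ.hom q) h
  rw [key]
  exact (MulEquiv.isUnit_map (Proj.stalkIso' gradS x).symm).trans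
    (isUnit_mapId_mk_iff x i n f _ hx)

theorem le_of_X_mem {J : Ideal S} (h : ∀ i, (MvPolynomial.X i : S) ∈ J) {n : ℕ} (hn : n ≠ 0) {f : S}
    (hf : f.IsHomogeneous n) : f ∈ J := by
  have hJ : Ideal.span (Set.range (MvPolynomial.X : Fin 4 → S)) ≤ J := by
    rw [Ideal.span_le]; rintro _ ⟨i, rfl⟩; exact h i
  refine hJ ?_
  rw [← Set.image_univ, MvPolynomial.mem_ideal_span_X_image]
  intro m hm
  have := hf.degree_eq_sum_deg_support hm
  by_contra! hc
  apply hn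
  rw [this]
  exact Finset.sum_eq_zero fun i _ => hc i (Set.mem_univ i)

theorem exists_mem_chart (x : P3) : ∃ i, x ∈ chart i := by
  by_contra! h
  apply (show ProjectiveSpectrum gradS from x).not_irrelevant_le
  have h1 : ∀ i, (MvPolynomial.X i : S) ∈ pointIdeal x := fun i => by
    by_contra hc
    exact h i hc
  intro f hf
  have hf' : MvPolynomial.homogeneousComponent 0 f = 0 :=
    by
    have := (HomogeneousIdeal.mem_irrelevant_iff _ _).1 hf
    exact (MvPolynomial.decomposition.decompose'_apply f 0).symm.trans this
  refine (MvPolynomial.mem_iff_homogeneousComponent_mem (pointIdeal_isHomogeneous x) f).2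
    fun n => ?_
  rcases eq_or_ne n 0 with rfl | hn
  · rw [hf']; exact zero_mem _
  · exact le_of_X_mem h1 hn (MvPolynomial.homogeneousComponent_isHomogeneous n f)

theorem dehomogenize_pow (i : Fin 4) (n : ℕ) (f : S) (hf : f ∈ gradS n) (M : ℕ) :
    dehomogenize i (n * M) (f ^ M) (MvPolynomial.IsHomogeneous.pow hf M) =
      dehomogenize i n f hf ^ M := by
  unfold dehomogenize
  rw [← map_pow]
  congr 1
  apply HomogeneousLocalization.val_injective
  rw [HomogeneousLocalization.val_pow, HomogeneousLocalization.Away.val_mk,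
    HomogeneousLocalization.Away.val_mk, Localization.mk_pow]
  congr 1
  ext
  simp [pow_mul]

theorem homogeneousIdeal_isHomogeneous {C : Scheme} (ι : C ⟶ P3) :
    (homogeneousIdeal ι).IsHomogeneous gradS :=
  Ideal.homogeneous_span _ _ fun _ ⟨n, hf, _⟩ => ⟨n, hf⟩

/-- The image is closed, so a point outside it is separated from it by a form `g` vanishing at all
points of `C`. Such a `g` is only nilpotent on the possibly non-reduced `C`, but then a power of `g`
lies in the homogeneous ideal, which is enough for a prime. -/
theorem mem_range_iff {C : Scheme} (ι : C ⟶ P3) [IsClosedImmersion ι] (x : P3) :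
    x ∈ Set.range ι ↔ homogeneousIdeal ι ≤ pointIdeal x := by
  constructor
  · rintro ⟨c, rfl⟩
    rw [homogeneousIdeal, Ideal.span_le]
    rintro f ⟨n, hf, h⟩
    obtain ⟨i, hi⟩ := exists_mem_chart (ι c)
    by_contra hfx
    have h1 := (mem_basicOpen_dehomogenize i n f hf _ hi).2 hfx
    have h2 : c ∈ ι ⁻¹ᵁ P3.basicOpen (dehomogenize i n f hf) := h1
    rw [Scheme.preimage_basicOpen, h i] at h2
    simp at h2
  · intro h
    by_contra hx
    have hcl : IsClosed (Set.range ι) := ι.isClosedEmbedding.isClosed_range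
    obtain ⟨s, hs⟩ := (ProjectiveSpectrum.isClosed_iff_zeroLocus gradS _).1 hcl
    have hx' : x ∉ ProjectiveSpectrum.zeroLocus gradS s := hs ▸ hx
    obtain ⟨f, hfs, hfx⟩ := Set.not_subset.1 hx'
    obtain ⟨n, hn⟩ : ∃ n, MvPolynomial.homogeneousComponent n f ∉ pointIdeal x := by
      by_contra! hc
      exact hfx (MvPolynomial.mem_iff_homogeneousComponent_mem (pointIdeal_isHomogeneous x) f |>.2 hc)
    set g := MvPolynomial.homogeneousComponent n f with hg
    have hgn : g ∈ gradS n := MvPolynomial.homogeneousComponent_mem n f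
    have hgc : ∀ c : C, g ∈ pointIdeal (ι c) := fun c => by
      have : ι c ∈ ProjectiveSpectrum.zeroLocus gradS s := hs ▸ ⟨c, rfl⟩
      exact MvPolynomial.homogeneousComponent_mem_of_mem (pointIdeal_isHomogeneous (ι c)) (this hfs) n
    -- The preimage of a chart is affine, hence compact, so a section with empty nonvanishing locus
    -- is nilpotent there.
    have hnil : ∀ i, IsNilpotent (ι.app (chart i) (dehomogenize i n g hgn)) := fun i => by
      rw [Scheme.isNilpotent_iff_basicOpen_eq_bot_of_isCompact, ← Scheme.preimage_basicOpen]
      · rw [eq_bot_iff]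
        intro c hc
        have hci : ι c ∈ chart i := P3.basicOpen_le _ hc
        exact ((mem_basicOpen_dehomogenize i n g hgn _ hci).1 hc (hgc c)).elim
      · exact ((Proj.isAffineOpen_basicOpen gradS (MvPolynomial.X i)
          (MvPolynomial.isHomogeneous_X ℂ i) one_pos).preimage ι).isCompact
    choose N hN using hnil
    -- One exponent that works on all four charts.
    set M := ∑ i, N i
    have hpow : g ^ M ∈ homogeneousIdeal ι := by
      refine Ideal.subset_span ⟨n * M, MvPolynomial.IsHomogeneous.pow hgn M, fun i => ?_⟩
      have : dehomogenize i (n * M) (g ^ M) (MvPolynomial.IsHomogeneous.pow hgn M) =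
          dehomogenize i n g hgn ^ M := dehomogenize_pow ..
      rw [this, map_pow]
      exact pow_eq_zero_of_le (Finset.single_le_sum (fun _ _ => Nat.zero_le _) (Finset.mem_univ i)) (hN i)
    exact hn (Ideal.IsPrime.mem_of_pow_mem inferInstance _ (h hpow))

/-! ### Dimension -/

theorem pointIdeal_le_iff (x y : P3) : pointIdeal x ≤ pointIdeal y ↔ x ⤳ y :=
  Iff.trans (ProjectiveSpectrum.le_iff_mem_closure gradS (show ProjectiveSpectrum gradS from x)
    (show ProjectiveSpectrum gradS from y)) specializes_iff_mem_closure.symm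

/-- Chains of homogeneous primes over the curve are reversed chains of irreducible closed subsets,
so the topological dimension of `C` can be used in `S`. -/
theorem pointIdeal_lt_iff {C : Scheme} (ι : C ⟶ P3) [IsClosedImmersion ι] (c d : C) :
    pointIdeal (ι c) < pointIdeal (ι d) ↔ closure {d} < closure {c} := by
  have h : ∀ c d : C, pointIdeal (ι c) ≤ pointIdeal (ι d) ↔ closure {d} ≤ closure {c} := by
    intro c d
    rw [pointIdeal_le_iff, ι.isClosedEmbedding.isInducing.specializes_iff,
      specializes_iff_closure_subset]
  rw [lt_iff_le_not_ge, lt_iff_le_not_ge, h, h]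

theorem exists_lt_of_isCurve {C : Scheme} {ι : C ⟶ P3} (hC : IsCurve ι) :
    ∃ x y : P3, homogeneousIdeal ι ≤ pointIdeal x ∧ pointIdeal x < pointIdeal y := by
  have := hC.isClosedImmersion
  have hdim : ((1 : ℕ) : WithBot ℕ∞) ≤ Order.krullDim (TopologicalSpace.IrreducibleCloseds C) :=
    hC.dim_eq_one.ge
  obtain ⟨p, hp⟩ := Order.le_krullDim_iff.1 hdim
  have hlt : p ⟨0, by omega⟩ < p ⟨1, by omega⟩ := p.strictMono (Fin.mk_lt_mk.2 one_pos)
  obtain ⟨c, hc⟩ := QuasiSober.sober (p ⟨1, by omega⟩).2 (p ⟨1, by omega⟩).3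
  obtain ⟨d, hd⟩ := QuasiSober.sober (p ⟨0, by omega⟩).2 (p ⟨0, by omega⟩).3
  refine ⟨ι c, ι d, (mem_range_iff ι _).1 ⟨c, rfl⟩, (pointIdeal_lt_iff ι c d).2 ?_⟩
  rw [hc.def, hd.def]
  exact hlt

theorem not_lt_lt_of_isCurve {C : Scheme} {ι : C ⟶ P3} (hC : IsCurve ι) (x y z : P3)
    (hx : homogeneousIdeal ι ≤ pointIdeal x) (hxy : pointIdeal x < pointIdeal y)
    (hyz : pointIdeal y < pointIdeal z) : False := by
  have := hC.isClosedImmersion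
  obtain ⟨x, rfl⟩ := (mem_range_iff ι _).2 hx
  obtain ⟨y, rfl⟩ := (mem_range_iff ι _).2 (hx.trans hxy.le)
  obtain ⟨z, rfl⟩ := (mem_range_iff ι _).2 (hx.trans (hxy.trans hyz).le)
  rw [pointIdeal_lt_iff] at hxy hyz
  let cl : C → TopologicalSpace.IrreducibleCloseds C := fun c =>
    ⟨closure {c}, isIrreducible_singleton.closure, isClosed_closure⟩
  have h1 : cl z < cl y := hyz
  have h2 : cl y < cl x := hxy
  have hdim : Order.krullDim (TopologicalSpace.IrreducibleCloseds C) < ((2 : ℕ) : WithBot ℕ∞) := by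
    rw [← topologicalKrullDim, hC.dim_eq_one]
    exact_mod_cast one_lt_two
  refine hdim.not_ge (Order.le_krullDim_iff.2 ⟨⟨2, ![cl z, cl y, cl x], ?_⟩, rfl⟩)
  intro i
  fin_cases i
  exacts [h1, h2]

/-! ### Linear forms -/

/-- The linear form with coefficients `c`. -/
def linearForm (c : Fin 4 → ℂ) : S := ∑ i, MvPolynomial.C (c i) * MvPolynomial.X i

theorem linearForm_isHomogeneous (c : Fin 4 → ℂ) : (linearForm c).IsHomogeneous 1 :=
  MvPolynomial.IsHomogeneous.sum _ _ _ fun i _ => MvPolynomial.isHomogeneous_C_mul_X (c i) i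

theorem aeval_linearForm {A : Type*} [CommRing A] [Algebra ℂ A] (g : Fin 4 → A) (c : Fin 4 → ℂ) :
    MvPolynomial.aeval g (linearForm c) = ∑ i, algebraMap ℂ A (c i) * g i := by
  simp [linearForm]

theorem eval_linearForm (p c : Fin 4 → ℂ) : MvPolynomial.eval p (linearForm c) = c ⬝ᵥ p := by
  simp [linearForm, dotProduct]

theorem exists_eq_linearForm {f : S} (hf : f.IsHomogeneous 1) : ∃ c, f = linearForm c := by
  have h : f ∈ MvPolynomial.homogeneousSubmodule (Fin 4) ℂ 1 := hf
  rw [MvPolynomial.homogeneousSubmodule_one_eq_span_X] at h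
  obtain ⟨c, hc⟩ := (Submodule.mem_span_range_iff_exists_fun ℂ).1 h
  exact ⟨c, by simp [← hc, linearForm, MvPolynomial.smul_eq_C_mul]⟩

theorem linearForm_ne_zero {c : Fin 4 → ℂ} (hc : c ≠ 0) : linearForm c ≠ 0 := by
  intro h
  apply hc
  funext i
  have := eval_linearForm (Pi.single i 1) c
  simpa [h] using this.symm

/-- Finitely many, but fewer than four, linear equations have a nontrivial solution. -/
theorem exists_ne_zero_dotProduct_eq_zero {n : ℕ} (hn : n < 4) (a : Fin n → Fin 4 → ℂ) :
    ∃ p : Fin 4 → ℂ, p ≠ 0 ∧ ∀ i, a i ⬝ᵥ p = 0 := by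
  have h := LinearMap.ker_ne_bot_of_finrank_lt (f := (Matrix.of a).mulVecLin) (by simpa using hn)
  obtain ⟨p, hp, hp0⟩ := (Submodule.ne_bot_iff _).1 h
  exact ⟨p, hp0, fun i => congrFun (LinearMap.mem_ker.1 hp) i⟩

theorem linearIndependent_pair_of_apply {u v : Fin 4 → ℂ} {i : Fin 4} (hu : u i ≠ 0)
    (hvi : v i = 0) (hv : v ≠ 0) : LinearIndependent ℂ ![u, v] := by
  refine LinearIndependent.pair_iff.2 fun s t h => ?_
  have hs : s = 0 := by simpa [hvi, hu] using congrFun h i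
  exact ⟨hs, by simpa [hs, hv] using h⟩

/-- Graded substitutions commute with taking homogeneous components. -/
theorem homogeneousComponent_aeval {σ τ R : Type*} [CommRing R] (g : σ → MvPolynomial τ R)
    (hg : ∀ i, (g i).IsHomogeneous 1) (n : ℕ) (f : MvPolynomial σ R) :
    MvPolynomial.homogeneousComponent n (MvPolynomial.aeval g f) =
      MvPolynomial.aeval g (MvPolynomial.homogeneousComponent n f) := by
  have h : ∀ m, (MvPolynomial.aeval g (MvPolynomial.homogeneousComponent m f)).IsHomogeneous m :=
    fun m => by
      simpa using (MvPolynomial.homogeneousComponent_isHomogeneous m f).aeval g hg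
  conv_lhs => rw [← MvPolynomial.sum_homogeneousComponent f]
  rw [map_sum, map_sum, Finset.sum_congr rfl fun m _ =>
    MvPolynomial.homogeneousComponent_of_mem (m := n) (h m), Finset.sum_ite_eq]
  split_ifs with hn
  · rfl
  · rw [MvPolynomial.homogeneousComponent_eq_zero _ _ (by simpa using hn), map_zero]

/-! ### Smooth quadrics -/

section Quadric

variable {F : S}

/-- Two planes in `ℙ³` meet, and at a common point their product vanishes together with all its
partial derivatives. -/
theorem IsSmoothQuadric.ne_mul (hF : IsSmoothQuadric F) {G H : S} (hG : G.IsHomogeneous 1)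
    (hH : H.IsHomogeneous 1) : F ≠ G * H := by
  rintro rfl
  obtain ⟨g, rfl⟩ := exists_eq_linearForm hG
  obtain ⟨h, rfl⟩ := exists_eq_linearForm hH
  obtain ⟨p, hp, hgh⟩ := exists_ne_zero_dotProduct_eq_zero (n := 2) (by norm_num) ![g, h]
  have hg : g ⬝ᵥ p = 0 := hgh 0
  have hh : h ⬝ᵥ p = 0 := hgh 1
  obtain ⟨i, hi⟩ := hF.smooth p hp (by simp [eval_linearForm, hg])
  apply hi
  simp [Derivation.leibniz, eval_linearForm, hg, hh]

theorem IsSmoothQuadric.ne_zero (hF : IsSmoothQuadric F) : F ≠ 0 := by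
  simpa using hF.ne_mul (MvPolynomial.isHomogeneous_zero (Fin 4) ℂ 1)
    (MvPolynomial.isHomogeneous_zero (Fin 4) ℂ 1)

theorem totalDegree_pos_of_not_isUnit {G : S} (hG : G ≠ 0) (h : ¬IsUnit G) :
    0 < G.totalDegree := by
  rw [pos_iff_ne_zero]
  intro h0
  rw [MvPolynomial.totalDegree_eq_zero_iff_eq_C] at h0
  apply h
  rw [h0] at hG ⊢
  exact (IsUnit.mk0 _ fun h' => hG (by rw [h', map_zero])).map _

theorem eq_add_C_of_totalDegree_eq_one {G : S} (h : G.totalDegree = 1) :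
    G = MvPolynomial.homogeneousComponent 1 G + MvPolynomial.C (G.coeff 0) := by
  conv_lhs => rw [← MvPolynomial.sum_homogeneousComponent G, h]
  simp [Finset.sum_range_succ, add_comm]

theorem IsSmoothQuadric.prime (hF : IsSmoothQuadric F) : Prime F := by
  have hdeg : F.totalDegree = 2 := hF.isHomogeneous.totalDegree hF.ne_zero
  rw [← irreducible_iff_prime]
  refine ⟨fun hu => ?_, fun G H hGH => ?_⟩
  · obtain ⟨c, hc, hc'⟩ := MvPolynomial.isUnit_iff_eq_C_of_isReduced.1 hu
    rw [hc', MvPolynomial.totalDegree_C] at hdeg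
    omega
  · by_contra! hc
    have h0 : G * H ≠ 0 := hGH ▸ hF.ne_zero
    have hG0 := left_ne_zero_of_mul h0
    have hH0 := right_ne_zero_of_mul h0
    have h1 := totalDegree_pos_of_not_isUnit hG0 hc.1
    have h2 := totalDegree_pos_of_not_isUnit hH0 hc.2
    rw [hGH, MvPolynomial.totalDegree_mul_of_isDomain hG0 hH0] at hdeg
    -- The factors need not be homogeneous a priori; the degree 2 component of the product shows
    -- that `F` is the product of their linear parts.
    have hG := eq_add_C_of_totalDegree_eq_one (G := G) (by omega)
    have hH := eq_add_C_of_totalDegree_eq_one (G := H) (by omega)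
    have hG1 := MvPolynomial.homogeneousComponent_isHomogeneous 1 G
    have hH1 := MvPolynomial.homogeneousComponent_isHomogeneous 1 H
    set G1 := MvPolynomial.homogeneousComponent 1 G
    set H1 := MvPolynomial.homogeneousComponent 1 H
    set g := G.coeff 0
    set h := H.coeff 0
    have e : F = G1 * H1 + (MvPolynomial.C g * H1 + MvPolynomial.C h * G1) +
      MvPolynomial.C (g * h) := by rw [hGH, hG, hH, map_mul]; ring
    refine hF.ne_mul hG1 hH1 ?_
    have e2 := congrArg (MvPolynomial.homogeneousComponent 2) e
    rw [map_add, map_add, MvPolynomial.homogeneousComponent_of_mem (m := 2) (n := 2) hF.isHomogeneous,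
      MvPolynomial.homogeneousComponent_of_mem (m := 2) (n := 2) (hG1.mul hH1),
      MvPolynomial.homogeneousComponent_of_mem (m := 2) (n := 1)
        ((hH1.C_mul g).add (hG1.C_mul h)),
      MvPolynomial.homogeneousComponent_of_mem (m := 2) (n := 0)
        (MvPolynomial.isHomogeneous_C _ (g * h))] at e2
    simpa using e2

theorem IsSmoothQuadric.linearForm_notMem (hF : IsSmoothQuadric F) {c : Fin 4 → ℂ} (hc : c ≠ 0) :
    linearForm c ∉ Ideal.span {F} := by
  rw [Ideal.mem_span_singleton]
  rintro ⟨G, hG⟩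
  have h0 := linearForm_ne_zero hc
  have h1 := (linearForm_isHomogeneous c).totalDegree h0
  rw [hG, MvPolynomial.totalDegree_mul_of_isDomain hF.ne_zero (right_ne_zero_of_mul (hG ▸ h0)),
    hF.isHomogeneous.totalDegree hF.ne_zero] at h1
  omega

/-- A quadratic form on `ℂ⁴` is given by a matrix. -/
theorem exists_matrix_of_isHomogeneous_two (hF : F.IsHomogeneous 2) :
    ∃ M : Matrix (Fin 4) (Fin 4) ℂ, ∀ p, 2 * MvPolynomial.eval p F = p ⬝ᵥ M.mulVec p := by
  choose c hc using fun i => exists_eq_linearForm (hF.pderiv (i := i))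
  refine ⟨Matrix.of c, fun p => ?_⟩
  have := congrArg (MvPolynomial.eval p) hF.sum_X_mul_pderiv
  simp [hc, eval_linearForm] at this
  rw [← this]
  rfl

/-- On the span of `a` and `b` the form is a binary quadratic form, which has a nontrivial zero over
an algebraically closed field. -/
theorem exists_isotropic (hF : F.IsHomogeneous 2) (a b : Fin 4 → ℂ) :
    ∃ s t : ℂ, (s ≠ 0 ∨ t ≠ 0) ∧ MvPolynomial.eval (s • a + t • b) F = 0 := by
  obtain ⟨M, hM⟩ := exists_matrix_of_isHomogeneous_two hF
  by_cases hb : MvPolynomial.eval b F = 0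
  · exact ⟨0, 1, by simp, by simpa using hb⟩
  · obtain ⟨t, ht⟩ := exists_quadratic_eq_zero (a := b ⬝ᵥ M.mulVec b)
      (b := a ⬝ᵥ M.mulVec b + b ⬝ᵥ M.mulVec a) (c := a ⬝ᵥ M.mulVec a)
      (by rw [← hM]; simpa using hb) (IsAlgClosed.exists_eq_mul_self _)
    refine ⟨1, t, by simp, ?_⟩
    have := hM ((1 : ℂ) • a + t • b)
    simp only [one_smul, Matrix.mulVec_add, Matrix.mulVec_smul, dotProduct_add, add_dotProduct,
      dotProduct_smul, smul_dotProduct, smul_eq_mul] at this ⊢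
    linear_combination (this + ht) / 2

/-- A quadric surface contains a line: take a zero `u` and a second zero `v` in the polar hyperplane
of `u`; all three coefficients of the form on their span then vanish. -/
theorem exists_isotropic_pair (hF : F.IsHomogeneous 2) :
    ∃ u v : Fin 4 → ℂ, LinearIndependent ℂ ![u, v] ∧
      ∀ s t : ℂ, MvPolynomial.eval (s • u + t • v) F = 0 := by
  obtain ⟨M, hM⟩ := exists_matrix_of_isHomogeneous_two hF
  obtain ⟨u, hu0, hu⟩ : ∃ u : Fin 4 → ℂ, u ≠ 0 ∧ MvPolynomial.eval u F = 0 := by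
    obtain ⟨s, t, hst, h⟩ := exists_isotropic hF (Pi.single 0 1) (Pi.single 1 1)
    refine ⟨_, fun h0 => ?_, h⟩
    rcases hst with hs | ht
    · exact hs (by simpa using congrFun h0 0)
    · exact ht (by simpa using congrFun h0 1)
  obtain ⟨i, hi⟩ := Function.ne_iff.1 hu0
  set f : Fin 4 → ℂ := M.vecMul u + M.mulVec u with hf
  have hfv : ∀ v, f ⬝ᵥ v = u ⬝ᵥ M.mulVec v + v ⬝ᵥ M.mulVec u := fun v => by
    rw [hf, add_dotProduct, Matrix.dotProduct_mulVec, dotProduct_comm v]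
  -- The condition `f ⬝ᵥ a = 0` is polarity to `u`; the vanishing `i`-th coordinate keeps the plane
  -- of candidates for `v` away from `u`, as `u i ≠ 0`.
  obtain ⟨a, ha0, ha⟩ := exists_ne_zero_dotProduct_eq_zero (n := 2) (by norm_num)
    ![f, Pi.single i 1]
  obtain ⟨j, hj⟩ := Function.ne_iff.1 ha0
  obtain ⟨b, hb0, hb⟩ := exists_ne_zero_dotProduct_eq_zero (n := 3) (by norm_num)
    ![f, Pi.single i 1, Pi.single j 1]
  have hab : LinearIndependent ℂ ![a, b] :=
    linearIndependent_pair_of_apply hj (by simpa using hb 2) hb0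
  obtain ⟨s, t, hst, h⟩ := exists_isotropic hF a b
  set v := s • a + t • b with hv
  have hv0 : v ≠ 0 := fun h0 => by
    have := LinearIndependent.pair_iff.1 hab s t h0
    tauto
  have hvi : v i = 0 := by
    have h1 : a i = 0 := by simpa using ha 1
    have h2 : b i = 0 := by simpa using hb 1
    simp [hv, h1, h2]
  have hvf : f ⬝ᵥ v = 0 := by
    have h1 : f ⬝ᵥ a = 0 := ha 0
    have h2 : f ⬝ᵥ b = 0 := hb 0
    simp [hv, h1, h2]
  refine ⟨u, v, linearIndependent_pair_of_apply hi hvi hv0, fun x y => ?_⟩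
  have e := hM (x • u + y • v)
  have e1 := hM u
  have e2 := hM v
  rw [hu] at e1
  rw [h] at e2
  rw [hfv] at hvf
  simp only [Matrix.mulVec_add, Matrix.mulVec_smul, dotProduct_add, add_dotProduct,
    dotProduct_smul, smul_dotProduct, smul_eq_mul] at e
  linear_combination (e - x ^ 2 * e1 - y ^ 2 * e2 + x * y * hvf) / 2

end Quadric

/-! ### Points and lines in projective space -/

theorem exists_pointIdeal_eq (J : Ideal S) [hp : J.IsPrime] (hJ : J.IsHomogeneous gradS)
    {i : Fin 4} (hi : (MvPolynomial.X i : S) ∉ J) : ∃ x : P3, pointIdeal x = J :=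
  ⟨(⟨⟨J, hJ⟩, hp, fun h => hi (h (HomogeneousIdeal.mem_irrelevant_of_mem gradS one_pos
    (MvPolynomial.isHomogeneous_X ℂ i)))⟩ : ProjectiveSpectrum gradS), rfl⟩

theorem ker_aeval_isHomogeneous {τ : Type*} (g : Fin 4 → MvPolynomial τ ℂ)
    (hg : ∀ i, (g i).IsHomogeneous 1) :
    (RingHom.ker (MvPolynomial.aeval (R := ℂ) g)).IsHomogeneous gradS := by
  intro n f hf
  rw [show ((DirectSum.decompose gradS f n : gradS n) : S) = _ from
    MvPolynomial.decomposition.decompose'_apply f n, RingHom.mem_ker,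
    ← homogeneousComponent_aeval g hg, RingHom.mem_ker.1 hf, map_zero]

/-- The parametrization `(s, t) ↦ s u + t v`, on the level of rings. -/
def lineMap (u v : Fin 4 → ℂ) (i : Fin 4) : MvPolynomial (Fin 2) ℂ :=
  MvPolynomial.C (u i) * MvPolynomial.X 0 + MvPolynomial.C (v i) * MvPolynomial.X 1

theorem lineMap_isHomogeneous (u v : Fin 4 → ℂ) (i : Fin 4) : (lineMap u v i).IsHomogeneous 1 :=
  (MvPolynomial.isHomogeneous_C_mul_X _ _).add (MvPolynomial.isHomogeneous_C_mul_X _ _)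

theorem eval_aeval_lineMap (u v : Fin 4 → ℂ) (p : Fin 2 → ℂ) (f : S) :
    MvPolynomial.eval p (MvPolynomial.aeval (lineMap u v) f) =
      MvPolynomial.eval (p 0 • u + p 1 • v) f := by
  have h : (MvPolynomial.aeval p).comp (MvPolynomial.aeval (lineMap u v)) =
      MvPolynomial.aeval (R := ℂ) (p 0 • u + p 1 • v) := by
    ext i
    simp [lineMap, mul_comm]
  simpa [MvPolynomial.coe_aeval_eq_eval] using DFunLike.congr_fun h f

/-- The ideal of the line through `u` and `v` (or of the point `u` if `v = 0`). -/
def lineIdeal (u v : Fin 4 → ℂ) : Ideal S := RingHom.ker (MvPolynomial.aeval (R := ℂ) (lineMap u v))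

instance (u v : Fin 4 → ℂ) : (lineIdeal u v).IsPrime := RingHom.ker_isPrime _

theorem mem_lineIdeal_iff {u v : Fin 4 → ℂ} {f : S} :
    f ∈ lineIdeal u v ↔ ∀ s t : ℂ, MvPolynomial.eval (s • u + t • v) f = 0 := by
  rw [lineIdeal, RingHom.mem_ker]
  constructor
  · intro h s t
    have := eval_aeval_lineMap u v ![s, t] f
    rw [h, map_zero] at this
    simpa using this.symm
  · intro h
    refine MvPolynomial.funext fun p => ?_
    rw [eval_aeval_lineMap, h, map_zero]

theorem exists_pointIdeal_eq_lineIdeal {u : Fin 4 → ℂ} (v : Fin 4 → ℂ) (hu : u ≠ 0) :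
    ∃ x : P3, pointIdeal x = lineIdeal u v := by
  obtain ⟨i, hi⟩ := Function.ne_iff.1 hu
  refine exists_pointIdeal_eq _ (ker_aeval_isHomogeneous _ (lineMap_isHomogeneous u v)) (i := i)
    fun h => hi ?_
  simpa using mem_lineIdeal_iff.1 h 1 0

/-- A curve is strictly smaller than the quadric containing it. -/
theorem exists_mem_notMem_span_of_isCurve {F : S} (hF : IsSmoothQuadric F) {C : Scheme}
    {ι : C ⟶ P3} (hC : IsCurve ι) :
    ∃ g ∈ homogeneousIdeal ι, g ∉ Ideal.span {F} := by
  by_contra! h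
  -- If `I ⊆ (F)`, the whole quadric lies on `C`, and its generic point, a line on it and a point of
  -- that line form a chain too long for dimension one. The linear form `c` separates the quadric
  -- from the line, and `d` the line from the point.
  obtain ⟨u, v, huv, hFuv⟩ := exists_isotropic_pair hF.isHomogeneous
  have hu : u ≠ 0 := huv.ne_zero 0
  have hprime : (Ideal.span {F}).IsPrime := (Ideal.span_singleton_prime hF.ne_zero).2 hF.prime
  obtain ⟨x, hx⟩ := exists_pointIdeal_eq (Ideal.span {F})
    (Ideal.homogeneous_span _ _ fun _ h => ⟨2, h ▸ hF.isHomogeneous⟩) (i := 0) (fun h0 =>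
      hF.linearForm_notMem (c := Pi.single 0 1) (by simp) (by
        simpa [linearForm, Pi.single_apply, Finset.sum_ite_eq] using h0))
  obtain ⟨y, hy⟩ := exists_pointIdeal_eq_lineIdeal v hu
  obtain ⟨z, hz⟩ := exists_pointIdeal_eq_lineIdeal 0 hu
  obtain ⟨c, hc0, hc⟩ := exists_ne_zero_dotProduct_eq_zero (n := 2) (by norm_num) ![u, v]
  have hcu : c ⬝ᵥ u = 0 := by rw [dotProduct_comm]; exact hc 0
  have hcv : c ⬝ᵥ v = 0 := by rw [dotProduct_comm]; exact hc 1
  obtain ⟨d, hdu, hdv⟩ : ∃ d : Fin 4 → ℂ, d ⬝ᵥ u = 0 ∧ d ⬝ᵥ v ≠ 0 := by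
    obtain ⟨i, hi⟩ := Function.ne_iff.1 hu
    by_contra! hd
    have h1 : ∀ j, u i * v j = v i * u j := fun j => by
      have := hd (u i • Pi.single j 1 - u j • Pi.single i 1) (by simp [mul_comm])
      simp at this
      linear_combination this
    have := LinearIndependent.pair_iff.1 huv (v i) (-u i) (by
      ext j; simp; linear_combination -h1 j)
    exact hi (by simpa using this.2)
  refine not_lt_lt_of_isCurve hC x y z ?_ ?_ ?_
  · rw [hx]; exact h
  · rw [hx, hy]
    refine lt_of_le_of_ne ?_ fun e => hF.linearForm_notMem hc0 ?_
    · rw [Ideal.span_singleton_le_iff_mem]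
      exact mem_lineIdeal_iff.2 hFuv
    · rw [e, mem_lineIdeal_iff]
      intro s t
      simp [eval_linearForm, hcu, hcv]
  · rw [hy, hz]
    refine lt_of_le_of_ne (fun f hf => ?_) fun e => hdv ?_
    · rw [mem_lineIdeal_iff] at hf ⊢
      intro s t
      simpa using hf s 0
    · have : linearForm d ∈ lineIdeal u v := by
        rw [e, mem_lineIdeal_iff]
        intro s t
        simp [eval_linearForm, hdu]
      simpa [eval_linearForm] using mem_lineIdeal_iff.1 this 0 1

/-! ### Dimension of the homogeneous coordinate ring -/

/-- Killing `F` in `S`, and then the nonzero image of `g` in the domain `S/(F)`, lowers the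
dimension 4 at least twice. -/
theorem ringKrullDim_quotient_le_two {F : S} (hF : Prime F) {I : Ideal S} (hFI : F ∈ I) {g : S}
    (hg : g ∈ I) (hgF : g ∉ Ideal.span {F}) : ringKrullDim (S ⧸ I) ≤ 2 := by
  have : (Ideal.span {F}).IsPrime := (Ideal.span_singleton_prime hF.ne_zero).2 hF
  have h1 := ringKrullDim_succ_le_of_surjective (Ideal.Quotient.mk (Ideal.span {F}))
    Ideal.Quotient.mk_surjective (r := F) (mem_nonZeroDivisors_of_ne_zero hF.ne_zero)
    (by simp)
  have h2 := ringKrullDim_succ_le_of_surjective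
    (Ideal.Quotient.factor (S := Ideal.span {F}) (T := I)
      ((Ideal.span_singleton_le_iff_mem I).2 hFI)) (Ideal.Quotient.factor_surjective _)
    (r := Ideal.Quotient.mk _ g)
    (mem_nonZeroDivisors_of_ne_zero (by simpa [Ideal.Quotient.eq_zero_iff_mem] using hgF))
    (by simpa [Ideal.Quotient.eq_zero_iff_mem] using hg)
  have h3 : ringKrullDim S = 4 := by
    rw [MvPolynomial.ringKrullDim_of_isNoetherianRing, ringKrullDim_eq_zero_of_field]
    simp
  rw [h3] at h1
  have h4 : ringKrullDim (S ⧸ I) + 1 + 1 ≤ 4 := le_trans (by gcongr) h1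
  generalize ringKrullDim (S ⧸ I) = d at h4
  induction d using WithBot.recBotCoe with
  | bot => simp
  | coe d =>
    have h5 : d + 1 + 1 ≤ 4 := WithBot.coe_le_coe.1 h4
    refine WithBot.coe_le_coe.2 ?_
    induction d using ENat.recTopCoe with
    | top => simp at h5
    | coe d => norm_cast at h5 ⊢; omega

/-- The irrelevant ideal of `S`. -/
abbrev irrelevantIdeal : Ideal S := Ideal.span (Set.range MvPolynomial.X)

theorem irrelevantIdeal_eq_ker :
    irrelevantIdeal = RingHom.ker (MvPolynomial.constantCoeff : S →+* ℂ) := by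
  refine le_antisymm ?_ fun f hf => ?_
  · rw [Ideal.span_le]
    rintro _ ⟨i, rfl⟩
    simp [RingHom.mem_ker]
  · have := sub_aeval_mem irrelevantIdeal (fun _ => 0)
      (fun i => by rw [sub_zero]; exact Ideal.subset_span ⟨i, rfl⟩) f
    rw [MvPolynomial.aeval_zero', RingHom.mem_ker.1 hf, map_zero, sub_zero] at this
    exact this

theorem mem_irrelevantIdeal_iff {f : S} : f ∈ irrelevantIdeal ↔ f.coeff 0 = 0 := by
  rw [irrelevantIdeal_eq_ker]
  rfl

instance : irrelevantIdeal.IsMaximal := by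
  rw [irrelevantIdeal_eq_ker]
  exact RingHom.ker_isMaximal_of_surjective _ fun c => ⟨MvPolynomial.C c, by simp⟩

theorem le_irrelevantIdeal {J : Ideal S} (hJ : J.IsHomogeneous gradS) (h : J ≠ ⊤) :
    J ≤ irrelevantIdeal := by
  intro f hf
  rw [mem_irrelevantIdeal_iff]
  by_contra hc
  have := MvPolynomial.homogeneousComponent_mem_of_mem hJ hf 0
  rw [MvPolynomial.homogeneousComponent_zero] at this
  exact h (Ideal.eq_top_of_isUnit_mem _ this ((IsUnit.mk0 _ hc).map _))

/-- Two nested point primes over the curve, followed by the irrelevant ideal, which is no point of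
`ℙ³`, form a chain of primes in the coordinate ring. -/
theorem two_le_height {C : Scheme} {ι : C ⟶ P3} (hC : IsCurve ι) :
    2 ≤ (irrelevantIdeal.map (Ideal.Quotient.mk (homogeneousIdeal ι))).height := by
  obtain ⟨x, y, hx, hxy⟩ := exists_lt_of_isCurve hC
  set I := homogeneousIdeal ι
  set π := Ideal.Quotient.mk I
  have hy : pointIdeal y < irrelevantIdeal := by
    refine lt_of_le_of_ne (le_irrelevantIdeal (pointIdeal_isHomogeneous y)
      (Ideal.IsPrime.ne_top inferInstance)) fun e => ?_
    obtain ⟨i, hi⟩ := exists_mem_chart y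
    refine hi ?_
    show MvPolynomial.X i ∈ pointIdeal y
    rw [e]
    exact Ideal.subset_span ⟨i, rfl⟩
  have hmap : ∀ J : Ideal S, J.IsPrime → I ≤ J → (J.map π).IsPrime := fun J hJ h =>
    Ideal.map_isPrime_of_surjective Ideal.Quotient.mk_surjective (by rwa [Ideal.mk_ker])
  have hlt : ∀ J K : Ideal S, I ≤ J → J < K → J.map π < K.map π := fun J K hI h => by
    refine lt_of_le_of_ne (Ideal.map_mono h.le) fun e => h.ne ?_
    have := congrArg (Ideal.comap π) e
    rwa [Ideal.comap_map_of_surjective' _ Ideal.Quotient.mk_surjective,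
      Ideal.comap_map_of_surjective' _ Ideal.Quotient.mk_surjective, Ideal.mk_ker,
      sup_eq_left.2 hI, sup_eq_left.2 (hI.trans h.le)] at this
  have := hmap _ inferInstance hx
  have := hmap _ inferInstance (hx.trans hxy.le)
  have := hmap irrelevantIdeal inferInstance (hx.trans (hxy.trans hy).le)
  have h1 := Ideal.height_add_one_le_of_lt_of_isPrime (hlt _ _ hx hxy)
  have h2 := Ideal.height_add_one_le_of_lt_of_isPrime (hlt _ _ (hx.trans hxy.le) hy)
  refine le_trans ?_ (le_trans (add_le_add_left h1 1) h2)
  rw [add_assoc, one_add_one_eq_two]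
  exact le_add_self

/-! ### Graded submodules of a free module of rank two over a polynomial ring in three variables -/

/-- The polynomial ring in three variables. -/
abbrev T : Type := MvPolynomial (Fin 3) ℂ

theorem homogeneousComponent_mul_of_isHomogeneous {σ R : Type*} [CommRing R] {d : ℕ}
    {g : MvPolynomial σ R} (hg : g.IsHomogeneous d) (n : ℕ) (f : MvPolynomial σ R) :
    MvPolynomial.homogeneousComponent (n + d) (g * f) =
      g * MvPolynomial.homogeneousComponent n f := by
  have h : ∀ m, (g * MvPolynomial.homogeneousComponent m f).IsHomogeneous (d + m) :=
    fun m => hg.mul (MvPolynomial.homogeneousComponent_isHomogeneous m f)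
  conv_lhs => rw [← MvPolynomial.sum_homogeneousComponent f]
  rw [Finset.mul_sum, map_sum, Finset.sum_congr rfl fun m _ =>
    MvPolynomial.homogeneousComponent_of_mem (m := n + d) (h m)]
  simp only [show ∀ m, (n + d = d + m) = (n = m) from fun m => by rw [eq_iff_iff]; omega]
  rw [Finset.sum_ite_eq]
  split_ifs with hn
  · rfl
  · rw [MvPolynomial.homogeneousComponent_eq_zero _ _ (by simpa using hn), mul_zero]

theorem homogeneousComponent_zero_mul_X {σ R : Type*} [CommRing R] (i : σ)
    (f : MvPolynomial σ R) : MvPolynomial.homogeneousComponent 0 (MvPolynomial.X i * f) = 0 := by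
  rw [MvPolynomial.homogeneousComponent_zero, ← MvPolynomial.constantCoeff_eq]
  simp

theorem aeval_algebraMap_mul {σ R A : Type*} [CommRing R] [CommRing A] [Algebra R A]
    {n : ℕ} {f : MvPolynomial σ R} (hf : f.IsHomogeneous n) (p : σ → R) (w : A) :
    MvPolynomial.aeval (fun i => algebraMap R A (p i) * w) f =
      algebraMap R A (MvPolynomial.eval p f) * w ^ n := by
  rw [MvPolynomial.aeval_def, MvPolynomial.eval₂_eq, MvPolynomial.eval_eq, map_sum, Finset.sum_mul]
  refine Finset.sum_congr rfl fun d hd => ?_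
  rw [hf.degree_eq_sum_deg_support hd, map_mul, map_prod, ← Finset.prod_pow_eq_pow_sum, mul_assoc,
    ← Finset.prod_mul_distrib]
  simp only [mul_pow, map_pow]

/-- The element `v` is homogeneous, for the grading of `T × T` in which the generators have
degrees `-1` and `0`. -/
def HomPair (m : ℕ) (v : T × T) : Prop := v.1.IsHomogeneous (m + 1) ∧ v.2.IsHomogeneous m

/-- The homogeneous component of a pair. -/
def compPair (m : ℕ) (v : T × T) : T × T :=
  (MvPolynomial.homogeneousComponent (m + 1) v.1, MvPolynomial.homogeneousComponent m v.2)

/-- Restriction of a pair to the third coordinate axis. -/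
def axisValue (v : T × T) : ℂ × ℂ :=
  (MvPolynomial.eval ![0, 0, 1] v.1, MvPolynomial.eval ![0, 0, 1] v.2)

theorem axisValue_sub (v w : T × T) : axisValue (v - w) = axisValue v - axisValue w := by
  simp [axisValue]

theorem axisValue_smul (s : T) (v : T × T) :
    axisValue (s • v) = MvPolynomial.eval ![0, 0, 1] s • axisValue v := by
  simp [axisValue]

theorem homPair_compPair (m : ℕ) (v : T × T) : HomPair m (compPair m v) :=
  ⟨MvPolynomial.homogeneousComponent_isHomogeneous _ _,
    MvPolynomial.homogeneousComponent_isHomogeneous _ _⟩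

theorem HomPair.compPair_eq {m : ℕ} {v : T × T} (h : HomPair m v) : compPair m v = v :=
  Prod.ext (MvPolynomial.homogeneousComponent_eq_self h.1)
    (MvPolynomial.homogeneousComponent_eq_self h.2)

theorem HomPair.sub {m : ℕ} {v w : T × T} (hv : HomPair m v) (hw : HomPair m w) :
    HomPair m (v - w) := ⟨hv.1.sub hw.1, hv.2.sub hw.2⟩

theorem homPair_zero (m : ℕ) : HomPair m 0 :=
  ⟨MvPolynomial.isHomogeneous_zero _ _ _, MvPolynomial.isHomogeneous_zero _ _ _⟩

theorem HomPair.smul {m d n : ℕ} {s : T} {v : T × T} (hv : HomPair m v) (hs : s.IsHomogeneous d)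
    (hn : n = d + m) : HomPair n (s • v) :=
  hn ▸ ⟨hs.mul hv.1, hs.mul hv.2⟩

theorem compPair_add (m : ℕ) (v w : T × T) :
    compPair m (v + w) = compPair m v + compPair m w := by
  simp [compPair]

theorem compPair_succ_X_smul (m : ℕ) (i : Fin 3) (v : T × T) :
    compPair (m + 1) ((MvPolynomial.X i : T) • v) = (MvPolynomial.X i : T) • compPair m v :=
  Prod.ext (homogeneousComponent_mul_of_isHomogeneous (MvPolynomial.isHomogeneous_X ℂ i) _ _)
    (homogeneousComponent_mul_of_isHomogeneous (MvPolynomial.isHomogeneous_X ℂ i) _ _)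

theorem compPair_zero_X_smul (i : Fin 3) (v : T × T) (h : v.1.coeff 0 = 0) :
    compPair 0 ((MvPolynomial.X i : T) • v) = 0 := by
  refine Prod.ext ?_ (homogeneousComponent_zero_mul_X _ _)
  show MvPolynomial.homogeneousComponent (0 + 1) (MvPolynomial.X i * v.1) = 0
  rw [homogeneousComponent_mul_of_isHomogeneous (MvPolynomial.isHomogeneous_X ℂ i),
    MvPolynomial.homogeneousComponent_zero, h, map_zero, mul_zero]

theorem sum_compPair (v : T × T) (h : v.1.coeff 0 = 0) :
    v = ∑ m ∈ Finset.range (v.1.totalDegree + v.2.totalDegree + 1), compPair m v := by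
  have key : ∀ (f : T) (N : ℕ), f.totalDegree < N →
      ∑ m ∈ Finset.range N, MvPolynomial.homogeneousComponent m f = f := fun f N hN => by
    conv_rhs => rw [← MvPolynomial.sum_homogeneousComponent f]
    refine (Finset.sum_subset (Finset.range_subset_range.2 hN) fun m _ hm =>
      MvPolynomial.homogeneousComponent_eq_zero _ _ (by simpa using hm)).symm
  refine Prod.ext ?_ ?_
  · rw [Prod.fst_sum]
    have := key v.1 (v.1.totalDegree + v.2.totalDegree + 1 + 1) (by omega)
    rw [Finset.sum_range_succ', MvPolynomial.homogeneousComponent_zero, h, map_zero,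
      add_zero] at this
    exact this.symm
  · rw [Prod.snd_sum]
    exact (key v.2 _ (by omega)).symm

theorem exists_eq_X_mul_add_of_eval_eq_zero {n : ℕ} {f : T} (hf : f.IsHomogeneous n)
    (h : MvPolynomial.eval ![0, 0, 1] f = 0) :
    ∃ a b : T, f = MvPolynomial.X 0 * a + MvPolynomial.X 1 * b := by
  have := sub_aeval_mem (Ideal.span {MvPolynomial.X 0, MvPolynomial.X 1})
    (fun i => algebraMap ℂ T ((![0, 0, 1] : Fin 3 → ℂ) i) * MvPolynomial.X 2) (fun i => by
      fin_cases i
      · simpa using (Ideal.subset_span (by simp) :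
          (MvPolynomial.X 0 : T) ∈ Ideal.span {MvPolynomial.X 0, MvPolynomial.X 1})
      · simpa using (Ideal.subset_span (by simp) :
          (MvPolynomial.X 1 : T) ∈ Ideal.span {MvPolynomial.X 0, MvPolynomial.X 1})
      · simp) f
  rw [aeval_algebraMap_mul hf, h, map_zero, zero_mul, sub_zero, Ideal.mem_span_pair] at this
  obtain ⟨a, b, rfl⟩ := this
  exact ⟨a, b, by ring⟩

/-- A graded submodule of `T × T` such that `X₀, X₁` is a regular sequence on the quotient. -/
structure IsGradedDeep (M : Submodule T (T × T)) : Prop where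
  comp_mem : ∀ v ∈ M, ∀ m, compPair m v ∈ M
  -- The constant term of the first entry has degree `-1`, which no `compPair m` sees; for a proper
  -- homogeneous ideal it is zero.
  coeff_zero : ∀ v ∈ M, v.1.coeff 0 = 0
  reg0 : ∀ v : T × T, (MvPolynomial.X 0 : T) • v ∈ M → v ∈ M
  reg1 : ∀ v w : T × T, (MvPolynomial.X 1 : T) • v + (MvPolynomial.X 0 : T) • w ∈ M →
    ∃ u : T × T, v + (MvPolynomial.X 0 : T) • u ∈ M

namespace IsGradedDeep

variable {M : Submodule T (T × T)}

/-- This is `M ∩ (X₀, X₁)(T × T) = (X₀, X₁)M` for homogeneous elements, the vanishing of a Tor of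
the quotient. A homogeneous pair with zero axis value vanishes modulo `(X₀, X₁)`, and regularity
moves the coefficients into `M`. -/
theorem exists_of_axisValue_eq_zero (hM : IsGradedDeep M) {m : ℕ} {v : T × T} (hv : v ∈ M)
    (hm : HomPair m v) (h0 : axisValue v = 0) :
    ∃ a ∈ M, ∃ b ∈ M, v = (MvPolynomial.X 0 : T) • a + (MvPolynomial.X 1 : T) • b := by
  obtain ⟨a₁, b₁, h₁⟩ := exists_eq_X_mul_add_of_eval_eq_zero hm.1 (congrArg Prod.fst h0)
  obtain ⟨a₂, b₂, h₂⟩ := exists_eq_X_mul_add_of_eval_eq_zero hm.2 (congrArg Prod.snd h0)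
  have e : v = (MvPolynomial.X 1 : T) • (b₁, b₂) + (MvPolynomial.X 0 : T) • (a₁, a₂) :=
    Prod.ext (by simp [h₁, add_comm]) (by simp [h₂, add_comm])
  obtain ⟨u, hu⟩ := hM.reg1 _ _ (e ▸ hv)
  refine ⟨(a₁, a₂) - (MvPolynomial.X 1 : T) • u, hM.reg0 _ ?_, _, hu, ?_⟩
  · convert M.sub_mem hv (M.smul_mem (MvPolynomial.X 1) hu) using 1
    rw [e]; module
  · rw [e]; module

/-- Graded Nakayama. By `H` the axis value of `v` is matched by a combination of the `cᵢX₂^(m -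
mᵢ)eᵢ`; the difference lies in `X₀M + X₁M`, and induction on the degree handles its coefficients.
Where `m < mᵢ` the scalar is zero, so the truncated exponent is harmless. -/
theorem exists_eq_smul_add_smul (hM : IsGradedDeep M) {e₁ e₂ : T × T} {m₁ m₂ : ℕ}
    (he₁ : e₁ ∈ M) (he₂ : e₂ ∈ M) (h₁ : HomPair m₁ e₁) (h₂ : HomPair m₂ e₂)
    (H : ∀ m, ∀ v ∈ M, HomPair m v → ∃ c₁ c₂ : ℂ,
      axisValue v = c₁ • axisValue e₁ + c₂ • axisValue e₂ ∧ (m < m₁ → c₁ = 0) ∧ (m < m₂ → c₂ = 0))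
    (m : ℕ) : ∀ v ∈ M, HomPair m v → ∃ s t : T, v = s • e₁ + t • e₂ ∧
      (s.IsHomogeneous (m - m₁) ∧ (m < m₁ → s = 0)) ∧
      (t.IsHomogeneous (m - m₂) ∧ (m < m₂ → t = 0)) := by
  have term : ∀ (m m' : ℕ) (c : ℂ) (e : T × T), HomPair m' e → (m < m' → c = 0) →
      HomPair m ((MvPolynomial.C c * MvPolynomial.X 2 ^ (m - m') : T) • e) := by
    intro m m' c e he hc
    rcases lt_or_ge m m' with h | h
    · rw [hc h]; simpa using homPair_zero m
    · exact he.smul (MvPolynomial.isHomogeneous_C_mul_X_pow c 2 (m - m')) (by omega)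
  have reduce : ∀ m, ∀ v ∈ M, HomPair m v → ∃ c₁ c₂ : ℂ, (m < m₁ → c₁ = 0) ∧ (m < m₂ → c₂ = 0) ∧
      ∃ a ∈ M, ∃ b ∈ M, v = (MvPolynomial.C c₁ * MvPolynomial.X 2 ^ (m - m₁) : T) • e₁ +
        (MvPolynomial.C c₂ * MvPolynomial.X 2 ^ (m - m₂) : T) • e₂ +
        compPair m ((MvPolynomial.X 0 : T) • a + (MvPolynomial.X 1 : T) • b) := by
    intro m v hv hvm
    obtain ⟨c₁, c₂, hc, hc₁, hc₂⟩ := H m v hv hvm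
    set s : T := MvPolynomial.C c₁ * MvPolynomial.X 2 ^ (m - m₁) with hs
    set t : T := MvPolynomial.C c₂ * MvPolynomial.X 2 ^ (m - m₂) with ht
    have hhom : HomPair m (v - s • e₁ - t • e₂) :=
      (hvm.sub (term m m₁ c₁ e₁ h₁ hc₁)).sub (term m m₂ c₂ e₂ h₂ hc₂)
    obtain ⟨a, ha, b, hb, hab⟩ := hM.exists_of_axisValue_eq_zero (v := v - s • e₁ - t • e₂)
      (M.sub_mem (M.sub_mem hv (M.smul_mem _ he₁)) (M.smul_mem _ he₂)) hhom (by
        rw [axisValue_sub, axisValue_sub, axisValue_smul, axisValue_smul, hc]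
        simp [hs, ht])
    refine ⟨c₁, c₂, hc₁, hc₂, a, ha, b, hb, ?_⟩
    rw [← hab, hhom.compPair_eq]
    module
  induction m with
  | zero =>
    intro v hv hvm
    obtain ⟨c₁, c₂, hc₁, hc₂, a, ha, b, hb, e⟩ := reduce 0 v hv hvm
    refine ⟨_, _, ?_, ⟨MvPolynomial.isHomogeneous_C_mul_X_pow c₁ 2 (0 - m₁), fun h => by simp [hc₁ h]⟩,
      ⟨MvPolynomial.isHomogeneous_C_mul_X_pow c₂ 2 (0 - m₂), fun h => by simp [hc₂ h]⟩⟩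
    -- In degree 0 only the degree `-1` parts of `a` and `b` could contribute, and these vanish by
    -- `coeff_zero`.
    rw [e, compPair_add, compPair_zero_X_smul _ _ (hM.coeff_zero a ha),
      compPair_zero_X_smul _ _ (hM.coeff_zero b hb), add_zero, add_zero]
  | succ m ih =>
    intro v hv hvm
    obtain ⟨c₁, c₂, hc₁, hc₂, a, ha, b, hb, e⟩ := reduce (m + 1) v hv hvm
    obtain ⟨s, t, hab, ⟨hs, hs0⟩, ht, ht0⟩ := ih _ (hM.comp_mem a ha m) (homPair_compPair m a)
    obtain ⟨s', t', hab', ⟨hs', hs0'⟩, ht', ht0'⟩ :=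
      ih _ (hM.comp_mem b hb m) (homPair_compPair m b)
    have step : ∀ (m' : ℕ) (c : ℂ) (s s' : T), (m + 1 < m' → c = 0) → s.IsHomogeneous (m - m') →
        (m < m' → s = 0) → s'.IsHomogeneous (m - m') → (m < m' → s' = 0) →
        (MvPolynomial.C c * MvPolynomial.X 2 ^ (m + 1 - m') + MvPolynomial.X 0 * s +
          MvPolynomial.X 1 * s' : T).IsHomogeneous (m + 1 - m') ∧
        (m + 1 < m' → (MvPolynomial.C c * MvPolynomial.X 2 ^ (m + 1 - m') + MvPolynomial.X 0 * s +
          MvPolynomial.X 1 * s' : T) = 0) := by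
      intro m' c s s' hc hs hs0 hs' hs0'
      refine ⟨?_, fun h => by simp [hc h, hs0 (by omega), hs0' (by omega)]⟩
      have hX := MvPolynomial.isHomogeneous_C_mul_X_pow c (2 : Fin 3) (m + 1 - m')
      rcases lt_or_ge m m' with h | h
      · simpa [hs0 h, hs0' h] using hX
      · have : m + 1 - m' = 1 + (m - m') := by omega
        rw [this] at hX ⊢
        exact (hX.add ((MvPolynomial.isHomogeneous_X ℂ _).mul hs)).add
          ((MvPolynomial.isHomogeneous_X ℂ _).mul hs')
    refine ⟨_, _, ?_, step m₁ c₁ s s' hc₁ hs hs0 hs' hs0', step m₂ c₂ t t' hc₂ ht ht0 ht' ht0'⟩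
    rw [e, compPair_add, compPair_succ_X_smul, compPair_succ_X_smul, hab, hab']
    module

/-- The pairs `e₁, e₂` of degrees `m₁ ≤ m₂` generate the graded module `M`. -/
structure Generates (M : Submodule T (T × T)) (e₁ e₂ : T × T) (m₁ m₂ : ℕ) : Prop where
  mem₁ : e₁ ∈ M
  mem₂ : e₂ ∈ M
  hom₁ : HomPair m₁ e₁
  hom₂ : HomPair m₂ e₂
  le : m₁ ≤ m₂
  span : ∀ m, ∀ v ∈ M, HomPair m v → ∃ s t : T, v = s • e₁ + t • e₂ ∧
      (s.IsHomogeneous (m - m₁) ∧ (m < m₁ → s = 0)) ∧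
      (t.IsHomogeneous (m - m₂) ∧ (m < m₂ → t = 0))

/-- Take `e₁` of least degree with nonzero axis value and `e₂` of least degree with axis value
independent of it; two suffice because axis values live in `ℂ²`. A generator that does not exist is
replaced by zero. -/
theorem exists_generates (hM : IsGradedDeep M) : ∃ (e₁ e₂ : T × T) (m₁ m₂ : ℕ),
    Generates M e₁ e₂ m₁ m₂ ∧ (e₂ = 0 ∨
      (axisValue e₁).1 * (axisValue e₂).2 - (axisValue e₁).2 * (axisValue e₂).1 ≠ 0) := by
  classical
  by_cases h1 : ∃ m, ∃ v ∈ M, HomPair m v ∧ axisValue v ≠ 0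
  · obtain ⟨e₁, he₁, hom₁, hne⟩ := Nat.find_spec h1
    set m₁ := Nat.find h1
    have hmin₁ : ∀ m, ∀ v ∈ M, HomPair m v → m < m₁ → axisValue v = 0 := fun m v hv hm hlt => by
      by_contra hc
      exact Nat.find_min h1 hlt ⟨v, hv, hm, hc⟩
    by_cases h2 : ∃ m, ∃ v ∈ M, HomPair m v ∧
        (axisValue e₁).1 * (axisValue v).2 - (axisValue e₁).2 * (axisValue v).1 ≠ 0
    · obtain ⟨e₂, he₂, hom₂, hdet⟩ := Nat.find_spec h2
      set m₂ := Nat.find h2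
      have hle : m₁ ≤ m₂ := by
        by_contra! hlt
        rw [hmin₁ m₂ e₂ he₂ hom₂ hlt] at hdet
        simp at hdet
      refine ⟨e₁, e₂, m₁, m₂, ⟨he₁, he₂, hom₁, hom₂, hle,
        hM.exists_eq_smul_add_smul he₁ he₂ hom₁ hom₂ ?_⟩, Or.inr hdet⟩
      intro m v hv hvm
      set D := (axisValue e₁).1 * (axisValue e₂).2 - (axisValue e₁).2 * (axisValue e₂).1
      refine ⟨((axisValue v).1 * (axisValue e₂).2 - (axisValue v).2 * (axisValue e₂).1) / D,
        ((axisValue e₁).1 * (axisValue v).2 - (axisValue e₁).2 * (axisValue v).1) / D, ?_, ?_, ?_⟩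
      · refine Prod.ext ?_ ?_ <;> simp only [Prod.fst_add, Prod.snd_add, Prod.smul_fst,
          Prod.smul_snd, smul_eq_mul] <;> field_simp <;> simp only [D] <;> ring
      · intro hlt
        simp [hmin₁ m v hv hvm hlt]
      · intro hlt
        have : (axisValue e₁).1 * (axisValue v).2 - (axisValue e₁).2 * (axisValue v).1 = 0 := by
          by_contra hc
          exact Nat.find_min h2 hlt ⟨v, hv, hvm, hc⟩
        rw [this, zero_div]
    -- All axis values are proportional to that of `e₁`; the degree `m₁` given to `e₂ = 0` is a
    -- dummy.
    · push Not at h2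
      refine ⟨e₁, 0, m₁, m₁, ⟨he₁, M.zero_mem, hom₁, homPair_zero _, le_rfl,
        hM.exists_eq_smul_add_smul he₁ M.zero_mem hom₁ (homPair_zero _) ?_⟩, Or.inl rfl⟩
      intro m v hv hvm
      have hd := h2 m v hv hvm
      by_cases hx : (axisValue e₁).1 = 0
      · have hy : (axisValue e₁).2 ≠ 0 := fun hy => hne (Prod.ext hx hy)
        refine ⟨(axisValue v).2 / (axisValue e₁).2, 0, ?_, fun hlt => by simp [hmin₁ m v hv hvm hlt],
          fun _ => rfl⟩
        have hv1 : (axisValue v).1 = 0 := by simpa [hx, hy] using hd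
        refine Prod.ext ?_ ?_
        · simp [hx, hv1]
        · simp [hy]
      · refine ⟨(axisValue v).1 / (axisValue e₁).1, 0, ?_, fun hlt => by simp [hmin₁ m v hv hvm hlt],
          fun _ => rfl⟩
        refine Prod.ext ?_ ?_
        · simp [hx]
        · simp; field_simp; linear_combination hd
  · push Not at h1
    refine ⟨0, 0, 0, 0, ⟨M.zero_mem, M.zero_mem, homPair_zero _, homPair_zero _, le_rfl,
      hM.exists_eq_smul_add_smul M.zero_mem M.zero_mem (homPair_zero _) (homPair_zero _) ?_⟩,
      Or.inl rfl⟩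
    intro m v hv hvm
    exact ⟨0, 0, by simp [h1 m v hv hvm], fun _ => rfl, fun _ => rfl⟩

theorem Generates.exists_eq (hM : IsGradedDeep M) {e₁ e₂ : T × T} {m₁ m₂ : ℕ}
    (h : Generates M e₁ e₂ m₁ m₂) {v : T × T} (hv : v ∈ M) : ∃ s t : T, v = s • e₁ + t • e₂ := by
  have : v ∈ Submodule.span T {e₁, e₂} := by
    rw [sum_compPair v (hM.coeff_zero v hv)]
    refine Submodule.sum_mem _ fun m _ => ?_
    obtain ⟨s, t, e, -⟩ := h.span m _ (hM.comp_mem v hv m) (homPair_compPair m v)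
    exact Submodule.mem_span_pair.2 ⟨s, t, e.symm⟩
  obtain ⟨s, t, e⟩ := Submodule.mem_span_pair.1 this
  exact ⟨s, t, e.symm⟩

end IsGradedDeep

/-- The determinant of the pairs is nonzero at a point, hence a nonzero polynomial, and Cramer's
rule applies. -/
theorem eq_zero_of_smul_add_smul_eq_zero {e₁ e₂ : T × T}
    (h : (axisValue e₁).1 * (axisValue e₂).2 - (axisValue e₁).2 * (axisValue e₂).1 ≠ 0) {s t : T}
    (hst : s • e₁ + t • e₂ = 0) : s = 0 ∧ t = 0 := by
  have hD : e₁.1 * e₂.2 - e₁.2 * e₂.1 ≠ 0 := fun h0 => h (by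
    simpa [axisValue] using congrArg (MvPolynomial.eval ![0, 0, 1]) h0)
  have h1 : s * e₁.1 + t * e₂.1 = 0 := congrArg Prod.fst hst
  have h2 : s * e₁.2 + t * e₂.2 = 0 := congrArg Prod.snd hst
  constructor
  · refine (mul_eq_zero.1 (?_ : s * (e₁.1 * e₂.2 - e₁.2 * e₂.1) = 0)).resolve_right hD
    linear_combination e₂.2 * h1 - e₂.1 * h2
  · refine (mul_eq_zero.1 (?_ : t * (e₁.1 * e₂.2 - e₁.2 * e₂.1) = 0)).resolve_right hD
    linear_combination e₁.1 * h2 - e₁.2 * h1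

/-! ### Ideals containing a quadric which is monic in the first variable -/

/-- The inclusion of the polynomial ring in the last three variables. -/
abbrev incl : T →ₐ[ℂ] S := MvPolynomial.rename Fin.succ

/-- The form `α + β X₀` attached to a pair `(α, β)`. -/
def toForm (v : T × T) : S := incl v.1 + incl v.2 * MvPolynomial.X 0

/-- The quadric `X₀² - p X₀ - q`. -/
def monicQuadric (p q : T) : S := MvPolynomial.X 0 ^ 2 - incl p * MvPolynomial.X 0 - incl q

/-- Multiplication by `X₀` modulo `monicQuadric p q`, in terms of pairs. -/
def mulX (p q : T) (v : T × T) : T × T := (q * v.2, v.1 + p * v.2)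

theorem toForm_add (v w : T × T) : toForm (v + w) = toForm v + toForm w := by
  simp [toForm]; ring

theorem toForm_smul (s : T) (v : T × T) : toForm (s • v) = incl s * toForm v := by
  simp [toForm]; ring

theorem X_mul_toForm (p q : T) (v : T × T) :
    MvPolynomial.X 0 * toForm v = toForm (mulX p q v) + incl v.2 * monicQuadric p q := by
  simp [toForm, mulX, monicQuadric]; ring

theorem toForm_isHomogeneous {m : ℕ} {v : T × T} (h : HomPair m v) :
    (toForm v).IsHomogeneous (m + 1) :=
  h.1.rename_isHomogeneous.add
    (h.2.rename_isHomogeneous.mul (MvPolynomial.isHomogeneous_X ℂ 0))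

theorem homogeneousComponent_toForm (m : ℕ) (v : T × T) :
    MvPolynomial.homogeneousComponent (m + 1) (toForm v) = toForm (compPair m v) := by
  rw [toForm, map_add, mul_comm, homogeneousComponent_mul_of_isHomogeneous
    (MvPolynomial.isHomogeneous_X ℂ 0), mul_comm, toForm, compPair]
  simp only [MvPolynomial.rename_homogeneousComponent]

theorem coeff_zero_toForm (v : T × T) : (toForm v).coeff 0 = v.1.coeff 0 := by
  simp only [toForm, ← MvPolynomial.constantCoeff_eq]
  simp [MvPolynomial.constantCoeff_rename]

/-- Division by a quadric monic in `X₀`. Together with `eq_zero_of_toForm_mem`, the uniqueness of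
the remainder, it makes `S/(monicQuadric p q)` free over `T` on `1, X₀`. -/
theorem exists_sub_toForm_mem (p q : T) (f : S) :
    ∃ v, f - toForm v ∈ Ideal.span {monicQuadric p q} := by
  induction f using MvPolynomial.induction_on with
  | C a => exact ⟨(MvPolynomial.C a, 0), by simp [toForm]⟩
  | add f g hf hg =>
    obtain ⟨v, hv⟩ := hf
    obtain ⟨w, hw⟩ := hg
    refine ⟨v + w, ?_⟩
    rw [toForm_add, add_sub_add_comm]
    exact add_mem hv hw
  | mul_X f i hf =>
    obtain ⟨v, hv⟩ := hf
    rw [Ideal.mem_span_singleton'] at hv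
    obtain ⟨a, ha⟩ := hv
    refine Fin.cases ?_ (fun i => ?_) i
    · refine ⟨mulX p q v, Ideal.mem_span_singleton'.2 ⟨a * MvPolynomial.X 0 + incl v.2, ?_⟩⟩
      linear_combination (MvPolynomial.X 0 : S) * ha - X_mul_toForm p q v
    · refine ⟨(MvPolynomial.X i : T) • v, Ideal.mem_span_singleton'.2
        ⟨a * MvPolynomial.X i.succ, ?_⟩⟩
      rw [toForm_smul, MvPolynomial.rename_X]
      linear_combination (MvPolynomial.X i.succ : S) * ha

theorem finSuccEquiv_incl (s : T) : MvPolynomial.finSuccEquiv ℂ 3 (incl s) = Polynomial.C s := by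
  have h : (MvPolynomial.finSuccEquiv ℂ 3).toAlgHom.comp incl = Polynomial.CAlgHom := by
    ext i
    simp [MvPolynomial.finSuccEquiv_X_succ]
  exact DFunLike.congr_fun h s

theorem eq_zero_of_toForm_mem (p q : T) {v : T × T}
    (h : toForm v ∈ Ideal.span {monicQuadric p q}) : v = 0 := by
  obtain ⟨a, ha⟩ := Ideal.mem_span_singleton.1 h
  have e := congrArg (MvPolynomial.finSuccEquiv ℂ 3) ha
  simp only [toForm, monicQuadric, map_add, map_sub, map_mul, map_pow, finSuccEquiv_incl,
    MvPolynomial.finSuccEquiv_X_zero] at e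
  set P : Polynomial T := Polynomial.X ^ 2 - Polynomial.C p * Polynomial.X - Polynomial.C q
    with hPdef
  have hP : P.Monic := by rw [hPdef]; monicity!
  have hPd : P.natDegree = 2 := by rw [hPdef]; compute_degree!
  set Q := MvPolynomial.finSuccEquiv ℂ 3 a
  have hQ : Q = 0 := by
    by_contra hQ
    have hdeg := congrArg Polynomial.natDegree e
    rw [hP.natDegree_mul' hQ, hPd] at hdeg
    have : (Polynomial.C v.1 + Polynomial.C v.2 * Polynomial.X).natDegree ≤ 1 := by
      compute_degree
    omega
  rw [hQ, mul_zero] at e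
  exact Prod.ext (by simpa using congrArg (Polynomial.coeff · 0) e)
    (by simpa using congrArg (Polynomial.coeff · 1) e)

section Core

variable {I : Ideal S} {p q : T}

/-- The pairs whose forms lie in `I`. -/
def pairs (I : Ideal S) : Submodule T (T × T) where
  carrier := {v | toForm v ∈ I}
  zero_mem' := by simp [toForm]
  add_mem' {v w} hv hw := by
    show toForm (v + w) ∈ I
    rw [toForm_add]; exact add_mem hv hw
  smul_mem' s v hv := by
    show toForm (s • v) ∈ I
    rw [toForm_smul]; exact I.mul_mem_left _ hv

theorem mem_pairs_iff {v : T × T} : v ∈ pairs I ↔ toForm v ∈ I := Iff.rfl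

theorem mulX_mem_pairs (hF : monicQuadric p q ∈ I) {v : T × T} (hv : v ∈ pairs I) :
    mulX p q v ∈ pairs I := by
  have := X_mul_toForm p q v
  rw [mem_pairs_iff, ← sub_eq_of_eq_add this]
  exact sub_mem (I.mul_mem_left _ hv) (I.mul_mem_left _ hF)

theorem homPair_mulX (hp : p.IsHomogeneous 1) (hq : q.IsHomogeneous 2) {m : ℕ} {v : T × T}
    (hv : HomPair m v) : HomPair (m + 1) (mulX p q v) := by
  constructor
  · have := hq.mul hv.2
    rwa [show 2 + m = m + 1 + 1 by ring] at this
  · have := hp.mul hv.2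
    rw [add_comm 1 m] at this
    exact hv.1.add this

theorem isGradedDeep_pairs (hI : I.IsHomogeneous gradS) (hI0 : I ≤ irrelevantIdeal)
    (hF : monicQuadric p q ∈ I)
    (h1 : ∀ f, MvPolynomial.X 1 * f ∈ I → f ∈ I)
    (h2 : ∀ f g, MvPolynomial.X 2 * f + MvPolynomial.X 1 * g ∈ I →
      ∃ h, f + MvPolynomial.X 1 * h ∈ I) : IsGradedDeep (pairs I) where
  comp_mem v hv m := by
    rw [mem_pairs_iff, ← homogeneousComponent_toForm]
    exact MvPolynomial.homogeneousComponent_mem_of_mem hI hv _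
  coeff_zero v hv := by
    rw [← coeff_zero_toForm]
    exact mem_irrelevantIdeal_iff.1 (hI0 hv)
  reg0 v hv := by
    rw [mem_pairs_iff, toForm_smul, MvPolynomial.rename_X] at hv
    exact h1 _ hv
  reg1 v w h := by
    rw [mem_pairs_iff, toForm_add, toForm_smul, toForm_smul, MvPolynomial.rename_X,
      MvPolynomial.rename_X] at h
    obtain ⟨g, hg⟩ := h2 _ _ h
    obtain ⟨u, hu⟩ := exists_sub_toForm_mem p q g
    refine ⟨u, ?_⟩
    rw [mem_pairs_iff, toForm_add, toForm_smul, MvPolynomial.rename_X]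
    have := I.mul_mem_left (MvPolynomial.X 1) (((Ideal.span_singleton_le_iff_mem I).2 hF) hu)
    convert sub_mem hg this using 1
    show _ + MvPolynomial.X 1 * _ = _
    ring

/-- If `X₀` acts on a nonzero pair as multiplication by `s`, then `s` is a root of the quadric. -/
theorem eq_zero_of_mulX_eq_smul {v : T × T} (hv : v ≠ 0) {s : T} (h : mulX p q v = s • v) :
    s ^ 2 - p * s - q = 0 := by
  have h1 : q * v.2 = s * v.1 := congrArg Prod.fst h
  have h2 : v.1 + p * v.2 = s * v.2 := congrArg Prod.snd h
  have h3 : (s ^ 2 - p * s - q) * v.2 = 0 := by linear_combination -h1 - s * h2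
  refine (mul_eq_zero.1 h3).resolve_right fun h0 => hv (Prod.ext ?_ h0)
  rw [h0] at h2
  simpa using h2

theorem mem_span_of_forall_pairs {J : Ideal S} (hF : monicQuadric p q ∈ I)
    (hFJ : monicQuadric p q ∈ J) (h : ∀ v ∈ pairs I, toForm v ∈ J) : I ≤ J := by
  intro f hf
  obtain ⟨v, hv⟩ := exists_sub_toForm_mem p q f
  have hvI : toForm v ∈ I := by
    have := sub_mem hf ((Ideal.span_singleton_le_iff_mem I).2 hF hv)
    simpa using this
  have := add_mem ((Ideal.span_singleton_le_iff_mem J).2 hFJ hv) (h v hvI)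
  simpa using this

/-- The ideal `I` is generated by `F` and two forms of degree `k + 1`, whose syzygies modulo `F`
are generated by the columns of a matrix `L` of linear forms. -/
def IsDeterminantalWith (I : Ideal S) (F : S) (k : ℕ) : Prop :=
  ∃ (e : Fin 2 → S) (L : Matrix (Fin 2) (Fin 2) S) (r : Fin 2 → S),
    (∀ i, (e i).IsHomogeneous (k + 1)) ∧ (∀ i j, (L i j).IsHomogeneous 1) ∧
    (∀ j, (r j).IsHomogeneous k) ∧ I = Ideal.span {F, e 0, e 1} ∧ L.det ≠ 0 ∧ e 0 ≠ 0 ∧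
    (∀ j, L 0 j * e 0 + L 1 j * e 1 = r j * F) ∧
    ∀ a : Fin 2 → S, a 0 * e 0 + a 1 * e 1 ∈ Ideal.span {F} → ∃ s, a = L.mulVec s

/-- Division with remainder by `X₀ - W`: a remainder `b` over `T` satisfies `X₀b = (X₀ - W)b + Wb`,
so remainders remain available after multiplication by `X₀`. -/
theorem exists_mulVec_add_incl (W : Matrix (Fin 2) (Fin 2) T) (a : Fin 2 → S) :
    ∃ (s : Fin 2 → S) (b : Fin 2 → T), a =
      (Matrix.scalar (Fin 2) (MvPolynomial.X 0) - W.map incl).mulVec s + fun i => incl (b i) := by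
  set L : Matrix (Fin 2) (Fin 2) S := Matrix.scalar (Fin 2) (MvPolynomial.X 0) - W.map incl with hL
  have hadd : ∀ a a' : Fin 2 → S, (∃ s, ∃ b : Fin 2 → T, a = L.mulVec s + fun i => incl (b i)) →
      (∃ s, ∃ b : Fin 2 → T, a' = L.mulVec s + fun i => incl (b i)) →
      ∃ s, ∃ b : Fin 2 → T, a + a' = L.mulVec s + fun i => incl (b i) := by
    rintro _ _ ⟨s, b, rfl⟩ ⟨s', b', rfl⟩
    refine ⟨s + s', b + b', ?_⟩
    ext i : 1
    simp only [Matrix.mulVec_add, Pi.add_apply, map_add]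
    ring
  have hmul : ∀ (i : Fin 4) (a : Fin 2 → S),
      (∃ s, ∃ b : Fin 2 → T, a = L.mulVec s + fun i => incl (b i)) →
      ∃ s, ∃ b : Fin 2 → T,
        (MvPolynomial.X i : S) • a = L.mulVec s + fun i => incl (b i) := by
    rintro i _ ⟨s, b, rfl⟩
    refine Fin.cases ?_ (fun i => ?_) i
    · refine ⟨(MvPolynomial.X 0 : S) • s + fun i => incl (b i), W.mulVec b, ?_⟩
      rw [smul_add, Matrix.mulVec_add, Matrix.mulVec_smul, add_assoc]
      congr 1
      rw [hL, Matrix.sub_mulVec]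
      ext i : 1
      fin_cases i <;> simp [Matrix.vecHead, Matrix.vecTail]
    · refine ⟨(MvPolynomial.X i.succ : S) • s, (MvPolynomial.X i : T) • b, ?_⟩
      rw [smul_add, Matrix.mulVec_smul]
      congr 1
      ext j : 1
      simp
  have hsingle : ∀ (j : Fin 2) (f : S),
      ∃ s, ∃ b : Fin 2 → T, Pi.single j f = L.mulVec s + fun i => incl (b i) := by
    intro j f
    induction f using MvPolynomial.induction_on with
    | C c =>
      refine ⟨0, Pi.single j (MvPolynomial.C c), ?_⟩
      ext i : 1
      rw [Matrix.mulVec_zero, zero_add]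
      rcases eq_or_ne i j with rfl | h
      · simp
      · simp [h]
    | add f g hf hg => rw [Pi.single_add]; exact hadd _ _ hf hg
    | mul_X f i hf =>
      have := hmul i _ hf
      rwa [← Pi.single_smul, smul_eq_mul, mul_comm] at this
  rw [show a = Pi.single 0 (a 0) + Pi.single 1 (a 1) by ext i : 1; fin_cases i <;> simp]
  exact hadd _ _ (hsingle 0 _) (hsingle 1 _)

/-- The heart of the classification: the action of `X₀` on the generators `e₁, e₂` of `pairs I`
decides which alternative holds, according to whether their degrees differ by one or agree. -/
theorem exists_generators_of_monicQuadric (hp : p.IsHomogeneous 1) (hq : q.IsHomogeneous 2)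
    (hroot : ∀ s : T, s.IsHomogeneous 1 → s ^ 2 - p * s - q ≠ 0)
    (hI : I.IsHomogeneous gradS) (hI0 : I ≤ irrelevantIdeal)
    (hF : monicQuadric p q ∈ I) (hne : ∃ g ∈ I, g ∉ Ideal.span {monicQuadric p q})
    (h1 : ∀ f, MvPolynomial.X 1 * f ∈ I → f ∈ I)
    (h2 : ∀ f g, MvPolynomial.X 2 * f + MvPolynomial.X 1 * g ∈ I →
      ∃ h, f + MvPolynomial.X 1 * h ∈ I) :
    (∃ (G : S) (d : ℕ), G.IsHomogeneous d ∧ I = Ideal.span {monicQuadric p q, G}) ∨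
      ∃ k, IsDeterminantalWith I (monicQuadric p q) k := by
  have hM := isGradedDeep_pairs hI hI0 hF h1 h2
  obtain ⟨e₁, e₂, m₁, m₂, hgen, hdet⟩ := hM.exists_generates
  have he₁0 : e₁ ≠ 0 := by
    rintro rfl
    have he₂ : e₂ = 0 := hdet.resolve_right (by simp [axisValue])
    obtain ⟨g, hg, hgF⟩ := hne
    refine hgF (mem_span_of_forall_pairs hF (Ideal.mem_span_singleton_self _) (fun v hv => ?_) hg)
    obtain ⟨s, t, rfl⟩ := hgen.exists_eq hM hv
    simp [he₂, toForm]
  obtain ⟨s₁, t₁, hw₁, ⟨hs₁, -⟩, ht₁, ht₁0⟩ := hgen.span (m₁ + 1) _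
    (mulX_mem_pairs hF hgen.mem₁) (homPair_mulX hp hq hgen.hom₁)
  rw [Nat.add_sub_cancel_left] at hs₁
  -- Otherwise `e₁` is an eigenvector of `X₀` with linear eigenvalue `s₁`, a root of the quadric.
  have key : t₁ • e₂ ≠ 0 := fun h0 =>
    hroot s₁ hs₁ (eq_zero_of_mulX_eq_smul he₁0 (by rw [hw₁, h0, add_zero]))
  have ht₁ne : t₁ ≠ 0 := fun h0 => key (by rw [h0, zero_smul])
  have he₂0 : e₂ ≠ 0 := fun h0 => key (by rw [h0, smul_zero])
  have hdet := hdet.resolve_left he₂0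
  have hm₂ : m₂ ≤ m₁ + 1 := by
    by_contra! hlt
    exact ht₁ne (ht₁0 hlt)
  -- If `m₂ = m₁ + 1`, then `t₁` is a nonzero constant, and the relation `X₀e₁ = s₁e₁ + t₁e₂` modulo
  -- `F` expresses `e₂` through `e₁` and `F`.
  rcases hm₂.eq_or_lt with rfl | hlt
  · left
    refine ⟨toForm e₁, m₁ + 1, toForm_isHomogeneous hgen.hom₁, le_antisymm ?_ ?_⟩
    · have hFJ : monicQuadric p q ∈ Ideal.span {monicQuadric p q, toForm e₁} :=
        Ideal.subset_span (by simp)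
      have heJ : toForm e₁ ∈ Ideal.span {monicQuadric p q, toForm e₁} :=
        Ideal.subset_span (by simp)
      refine mem_span_of_forall_pairs hF hFJ fun v hv => ?_
      obtain ⟨s, t, rfl⟩ := hgen.exists_eq hM hv
      rw [toForm_add, toForm_smul, toForm_smul]
      refine add_mem (Ideal.mul_mem_left _ _ heJ) (Ideal.mul_mem_left _ _ ?_)
      rw [Nat.sub_self, ← MvPolynomial.totalDegree_zero_iff_isHomogeneous,
        MvPolynomial.totalDegree_eq_zero_iff_eq_C] at ht₁
      set c := t₁.coeff 0
      have hc : c ≠ 0 := fun h0 => ht₁ne (by rw [ht₁, h0, map_zero])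
      have e := X_mul_toForm p q e₁
      rw [hw₁, toForm_add, toForm_smul, toForm_smul, ht₁] at e
      have hC : (MvPolynomial.C c⁻¹ : S) * MvPolynomial.C c = 1 := by
        rw [← map_mul, inv_mul_cancel₀ hc, map_one]
      have : toForm e₂ = MvPolynomial.C c⁻¹ * ((MvPolynomial.X 0 - incl s₁) * toForm e₁ -
          incl e₁.2 * monicQuadric p q) := by
        simp only [MvPolynomial.rename_C] at e
        linear_combination -toForm e₂ * hC - (MvPolynomial.C c⁻¹ : S) * e
      rw [this]
      exact Ideal.mul_mem_left _ _ (sub_mem (Ideal.mul_mem_left _ _ heJ) (Ideal.mul_mem_left _ _ hFJ))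
    · rw [Ideal.span_le]
      rintro _ (rfl | rfl)
      exacts [hF, hgen.mem₁]
  · right
    obtain rfl : m₂ = m₁ := le_antisymm (by omega) hgen.le
    obtain ⟨s₂, t₂, hw₂, ⟨hs₂, -⟩, ht₂, -⟩ := hgen.span (m₂ + 1) _
      (mulX_mem_pairs hF hgen.mem₂) (homPair_mulX hp hq hgen.hom₂)
    rw [Nat.add_sub_cancel_left] at ht₁ hs₂ ht₂
    -- The matrix of multiplication by `X₀` on `e₁, e₂`; its entries are linear because the two
    -- degrees agree.
    set W : Matrix (Fin 2) (Fin 2) T := !![s₁, s₂; t₁, t₂] with hW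
    have hWhom : ∀ i j, (W i j).IsHomogeneous 1 := by
      intro i j
      fin_cases i <;> fin_cases j <;> assumption
    refine ⟨m₂, ![toForm e₁, toForm e₂], Matrix.scalar (Fin 2) (MvPolynomial.X 0) - W.map incl,
      ![incl e₁.2, incl e₂.2], ?_, ?_, ?_, ?_, ?_, ?_, ?_, ?_⟩
    · intro i
      fin_cases i
      exacts [toForm_isHomogeneous hgen.hom₁, toForm_isHomogeneous hgen.hom₂]
    · intro i j
      refine MvPolynomial.IsHomogeneous.sub ?_ (hWhom i j).rename_isHomogeneous
      rw [Matrix.scalar_apply, Matrix.diagonal_apply]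
      split_ifs
      exacts [MvPolynomial.isHomogeneous_X ℂ 0, MvPolynomial.isHomogeneous_zero _ _ _]
    · intro i
      fin_cases i
      exacts [hgen.hom₁.2.rename_isHomogeneous, hgen.hom₂.2.rename_isHomogeneous]
    · refine le_antisymm (mem_span_of_forall_pairs hF (Ideal.subset_span (by simp))
        fun v hv => ?_) ?_
      · obtain ⟨s, t, rfl⟩ := hgen.exists_eq hM hv
        rw [toForm_add, toForm_smul, toForm_smul]
        exact add_mem (Ideal.mul_mem_left _ _ (Ideal.subset_span (by simp)))
          (Ideal.mul_mem_left _ _ (Ideal.subset_span (by simp)))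
      · rw [Ideal.span_le]
        rintro _ (rfl | rfl | rfl)
        exacts [hF, hgen.mem₁, hgen.mem₂]
    · intro h0
      -- At `(1, 0, 0, 0)` the linear entries of `W` vanish and `X₀ - W` becomes the identity.
      have h3 := congrArg (MvPolynomial.eval (Fin.cons 1 0 : Fin 4 → ℂ)) h0
      have hev : ∀ i j, MvPolynomial.eval (Fin.cons 1 0 : Fin 4 → ℂ) (incl (W i j)) = 0 := by
        intro i j
        rw [MvPolynomial.eval_rename, show (Fin.cons 1 0 : Fin 4 → ℂ) ∘ Fin.succ = 0 from
          Fin.cons_comp_succ _ _, MvPolynomial.eval_zero, MvPolynomial.constantCoeff_eq]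
        exact (hWhom i j).coeff_eq_zero (by simp)
      rw [Matrix.det_fin_two] at h3
      simp [hev] at h3
    · intro h0
      exact he₁0 (eq_zero_of_toForm_mem p q (by
        rw [show toForm e₁ = 0 from h0]; exact zero_mem _))
    · intro j
      have e1 := X_mul_toForm p q e₁
      have e2 := X_mul_toForm p q e₂
      rw [hw₁, toForm_add, toForm_smul, toForm_smul] at e1
      rw [hw₂, toForm_add, toForm_smul, toForm_smul] at e2
      fin_cases j
      · simp [W]; linear_combination e1
      · simp [W]; linear_combination e2
    · intro a ha
      -- Columns of `X₀ - W` are syzygies modulo `F`, so the remainder `b` is one too; having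
      -- entries in `T`, it is a `T`-linear relation between `e₁` and `e₂`, hence zero.
      obtain ⟨s, b, hab⟩ := exists_mulVec_add_incl W a
      refine ⟨s, ?_⟩
      suffices hb : b 0 = 0 ∧ b 1 = 0 by
        rw [hab]
        ext i : 1
        fin_cases i <;> simp [hb]
      apply eq_zero_of_smul_add_smul_eq_zero hdet
      apply eq_zero_of_toForm_mem p q
      rw [toForm_add, toForm_smul, toForm_smul]
      have e1 := X_mul_toForm p q e₁
      have e2 := X_mul_toForm p q e₂
      rw [hw₁, toForm_add, toForm_smul, toForm_smul] at e1
      rw [hw₂, toForm_add, toForm_smul, toForm_smul] at e2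
      convert sub_mem ha (Ideal.mul_mem_left _ (s 0 * incl e₁.2 + s 1 * incl e₂.2)
        (Ideal.mem_span_singleton_self (monicQuadric p q))) using 1
      rw [hab]
      simp [W]
      linear_combination -s 0 * e1 - s 1 * e2

end Core

/-! ### Generic linear forms -/

theorem linearForm_add (c d : Fin 4 → ℂ) : linearForm (c + d) = linearForm c + linearForm d := by
  simp [linearForm, add_mul, Finset.sum_add_distrib]

theorem linearForm_smul (a : ℂ) (c : Fin 4 → ℂ) : linearForm (a • c) = a • linearForm c := by
  simp [linearForm, MvPolynomial.smul_eq_C_mul, Finset.mul_sum, mul_assoc]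

theorem linearForm_single (i : Fin 4) : linearForm (Pi.single i 1) = MvPolynomial.X i := by
  simp [linearForm, Pi.single_apply, apply_ite MvPolynomial.C, ite_mul]

theorem linearForm_mem_irrelevantIdeal (c : Fin 4 → ℂ) : linearForm c ∈ irrelevantIdeal :=
  Ideal.sum_mem _ fun i _ => Ideal.mul_mem_left _ _ (Ideal.subset_span ⟨i, rfl⟩)

/-- A prime ideal containing `F` and all linear forms vanishing at a point outside the quadric
contains all linear forms. -/
theorem irrelevantIdeal_le {F : S} (hF : F.IsHomogeneous 2) {p : Fin 4 → ℂ}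
    (hp : MvPolynomial.eval p F ≠ 0) {J : Ideal S} [J.IsPrime] (hFJ : F ∈ J)
    (h : ∀ c : Fin 4 → ℂ, c ⬝ᵥ p = 0 → linearForm c ∈ J) : irrelevantIdeal ≤ J := by
  have hp0 : p ≠ 0 := by
    rintro rfl
    rw [MvPolynomial.eval_zero, MvPolynomial.constantCoeff_eq] at hp
    exact hp (hF.coeff_eq_zero (by simp))
  obtain ⟨i, hi⟩ := Function.ne_iff.1 hp0
  have hi : p i ≠ 0 := hi
  set w : S := MvPolynomial.C (p i)⁻¹ * MvPolynomial.X i with hw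
  have hsub : ∀ j, MvPolynomial.X j - algebraMap ℂ S (p j) * w ∈ J := fun j => by
    have := h (Pi.single j 1 - (p j * (p i)⁻¹) • Pi.single i 1) (by
      simp [sub_dotProduct, smul_dotProduct, hi])
    rw [sub_eq_add_neg, ← neg_smul, linearForm_add, linearForm_smul, linearForm_single,
      linearForm_single] at this
    convert this using 1
    rw [hw, MvPolynomial.algebraMap_eq, MvPolynomial.smul_eq_C_mul, map_neg, map_mul]
    ring
  have hFw := sub_mem hFJ (sub_aeval_mem J _ hsub F)
  rw [sub_sub_cancel, aeval_algebraMap_mul hF] at hFw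
  have hw' : w ∈ J := by
    rcases ‹J.IsPrime›.mem_or_mem hFw with h1 | h1
    · exact (‹J.IsPrime›.ne_top (Ideal.eq_top_of_isUnit_mem _ h1
        ((IsUnit.mk0 _ hp).map _))).elim
    · exact ‹J.IsPrime›.mem_of_pow_mem _ h1
  rw [Ideal.span_le]
  rintro _ ⟨j, rfl⟩
  have := add_mem (hsub j) (J.mul_mem_left (algebraMap ℂ S (p j)) hw')
  simpa using this

/-- The linear forms vanishing at `p`, given by their coefficients. -/
def vanishingAt (p : Fin 4 → ℂ) : Submodule ℂ (Fin 4 → ℂ) where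
  carrier := {c | c ⬝ᵥ p = 0}
  zero_mem' := by simp
  add_mem' {c d} (hc : c ⬝ᵥ p = 0) (hd : d ⬝ᵥ p = 0) := by
    show (c + d) ⬝ᵥ p = 0
    rw [add_dotProduct, hc, hd, add_zero]
  smul_mem' a c (hc : c ⬝ᵥ p = 0) := by
    show (a • c) ⬝ᵥ p = 0
    rw [smul_dotProduct, hc, smul_zero]

theorem finrank_vanishingAt (p : Fin 4 → ℂ) :
    2 < Module.finrank ℂ (vanishingAt p) := by
  let g : (Fin 4 → ℂ) →ₗ[ℂ] ℂ := Fintype.linearCombination ℂ p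
  have hker : LinearMap.ker g = vanishingAt p := by
    ext c
    simp [g, Fintype.linearCombination_apply, vanishingAt, dotProduct]
  have h := LinearMap.finrank_range_add_finrank_ker g
  have h1 := (LinearMap.range g).finrank_le
  rw [hker, Module.finrank_fin_fun] at h
  rw [Module.finrank_self] at h1
  omega

/-- A vector space over `ℂ` is not a finite union of proper subspaces. Each associated prime of `M`
contains `F`, so containing all linear forms that vanish at `p` would force it to contain the
irrelevant ideal, which kills no nonzero element. -/
theorem exists_isSMulRegular_linearForm {F : S} (hF : F.IsHomogeneous 2) {p : Fin 4 → ℂ}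
    (hp : MvPolynomial.eval p F ≠ 0) {M : Type*} [AddCommGroup M] [Module S M] [Module.Finite S M]
    (hFM : ∀ x : M, F • x = 0) (h : ∀ x : M, (∀ z ∈ irrelevantIdeal, z • x = 0) → x = 0) :
    ∃ c ∈ vanishingAt p, IsSMulRegular M (linearForm c) := by
  classical
  let N : Ideal S → Submodule ℂ (vanishingAt p) := fun J =>
    { carrier := {c | linearForm c ∈ J}
      zero_mem' := by simp [linearForm]
      add_mem' := fun {c d} hc hd => by
        show linearForm (c + d : Fin 4 → ℂ) ∈ J
        rw [linearForm_add]; exact add_mem hc hd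
      smul_mem' := fun a c hc => by
        show linearForm (a • (c : Fin 4 → ℂ)) ∈ J
        rw [linearForm_smul, MvPolynomial.smul_eq_C_mul]; exact J.mul_mem_left _ hc }
  have hfin := associatedPrimes.finite S M
  have htop : ⊤ ∉ hfin.toFinset.image N := by
    intro hmem
    obtain ⟨J, hJ, hN⟩ := Finset.mem_image.1 hmem
    obtain ⟨hJp, x, hx⟩ := isAssociatedPrime_iff.1 (hfin.mem_toFinset.1 hJ)
    have hmemJ : ∀ z, z ∈ J ↔ z • x = 0 := fun z => by rw [hx]; simp [Submodule.mem_colon]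
    have hle := irrelevantIdeal_le hF hp ((hmemJ F).2 (hFM x)) fun c hc => by
      have : (⟨c, hc⟩ : vanishingAt p) ∈ N J := hN ▸ Submodule.mem_top
      exact this
    have hx0 : x = 0 := h x fun z hz => (hmemJ z).1 (hle hz)
    exact hJp.ne_top ((Ideal.eq_top_iff_one J).2 ((hmemJ 1).2 (by rw [hx0, smul_zero])))
  have hne := Subspace.biUnion_ne_univ_of_top_notMem htop
  obtain ⟨c, hc⟩ := (Set.ne_univ_iff_exists_notMem _).1 hne
  refine ⟨c, c.2, ?_⟩
  by_contra hreg
  have : linearForm c ∈ ⋃ J ∈ associatedPrimes S M, (J : Set S) := by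
    rw [biUnion_associatedPrimes_eq_compl_regular]
    exact hreg
  simp only [Set.mem_iUnion] at this hc
  obtain ⟨J, hJ, hcJ⟩ := this
  exact hc ⟨N J, Finset.mem_image_of_mem _ (hfin.mem_toFinset.2 hJ), hcJ⟩

/-- Depth does not depend on the chosen first element: after passing to the quotient by any
nonzerodivisor `y`, no nonzero element is killed by both `f` and `g`. -/
theorem dvd_of_dvd_mul_of_isRegular_pair {R : Type*} [CommRing R] {f g y x : R}
    (hfg : IsRegular R [f, g]) (hy : ∀ x, y * x = 0 → x = 0) (hf : y ∣ f * x) (hg : y ∣ g * x) :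
    y ∣ x := by
  obtain ⟨h1, h2, -⟩ := isRegular_pair_iff.1 hfg
  obtain ⟨t, ht⟩ := hf
  obtain ⟨u, hu⟩ := hg
  have h3 : g * t - f * u = 0 := hy _ (by linear_combination f * hu - g * ht)
  obtain ⟨v, rfl⟩ := h2 t ⟨u, by linear_combination h3⟩
  exact ⟨v, by rw [← sub_eq_zero]; exact h1 _ (by linear_combination ht)⟩

theorem exists_regular_linearForms {F : S} (hF : F.IsHomogeneous 2) {p : Fin 4 → ℂ}
    (hp : MvPolynomial.eval p F ≠ 0) {I : Ideal S} (hFI : F ∈ I) {f g : S ⧸ I}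
    (hf : f ∈ irrelevantIdeal.map (Ideal.Quotient.mk I))
    (hg : g ∈ irrelevantIdeal.map (Ideal.Quotient.mk I)) (hfg : IsRegular (S ⧸ I) [f, g]) :
    ∃ c ∈ vanishingAt p, ∃ d ∈ vanishingAt p, (∀ x, linearForm c * x ∈ I → x ∈ I) ∧
      ∀ x y, linearForm d * x + linearForm c * y ∈ I → ∃ z, x + linearForm c * z ∈ I := by
  obtain ⟨f, hf', rfl⟩ := (Ideal.mem_map_iff_of_surjective _ Ideal.Quotient.mk_surjective).1 hf
  obtain ⟨g, hg', rfl⟩ := (Ideal.mem_map_iff_of_surjective _ Ideal.Quotient.mk_surjective).1 hg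
  obtain ⟨c, hc, hcr⟩ := exists_isSMulRegular_linearForm hF hp (M := S ⧸ I)
    (fun x => by
      obtain ⟨x, rfl⟩ := Ideal.Quotient.mk_surjective x
      exact Ideal.Quotient.eq_zero_iff_mem.2 (I.mul_mem_right _ hFI))
    (fun x hx => (isRegular_pair_iff.1 hfg).1 x (hx f hf'))
  have hcr1 : ∀ x, linearForm c * x ∈ I → x ∈ I := (isSMulRegular_quotient_iff_mem_of_smul_mem I _).1 hcr
  have hcr2 : ∀ x : S ⧸ I, Ideal.Quotient.mk I (linearForm c) * x = 0 → x = 0 := fun x hx => by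
    obtain ⟨x, rfl⟩ := Ideal.Quotient.mk_surjective x
    rw [← map_mul, Ideal.Quotient.eq_zero_iff_mem] at hx
    exact Ideal.Quotient.eq_zero_iff_mem.2 (hcr1 x hx)
  have hdvd : ∀ x y : S, Ideal.Quotient.mk I x ∣ Ideal.Quotient.mk I y ↔
      y ∈ I ⊔ Ideal.span {x} := fun x y => by
    rw [sup_comm, Ideal.mem_span_singleton_sup]
    constructor
    · rintro ⟨t, ht⟩
      obtain ⟨t, rfl⟩ := Ideal.Quotient.mk_surjective t
      rw [← map_mul, Ideal.Quotient.eq] at ht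
      exact ⟨t, _, ht, by ring⟩
    · rintro ⟨t, b, hb, rfl⟩
      refine ⟨Ideal.Quotient.mk I t, ?_⟩
      rw [map_add, Ideal.Quotient.eq_zero_iff_mem.2 hb, add_zero, map_mul, mul_comm]
  obtain ⟨d, hd, hdr⟩ := exists_isSMulRegular_linearForm hF hp (M := S ⧸ (I ⊔ Ideal.span {linearForm c}))
    (fun x => by
      obtain ⟨x, rfl⟩ := Ideal.Quotient.mk_surjective x
      exact Ideal.Quotient.eq_zero_iff_mem.2 (Ideal.mul_mem_right _ _ (Ideal.mem_sup_left hFI)))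
    (fun x hx => by
      obtain ⟨x, rfl⟩ := Ideal.Quotient.mk_surjective x
      rw [Ideal.Quotient.eq_zero_iff_mem, ← hdvd]
      refine dvd_of_dvd_mul_of_isRegular_pair hfg hcr2 ?_ ?_
      · rw [← map_mul, hdvd]
        exact Ideal.Quotient.eq_zero_iff_mem.1 (hx f hf')
      · rw [← map_mul, hdvd]
        exact Ideal.Quotient.eq_zero_iff_mem.1 (hx g hg'))
  refine ⟨c, hc, d, hd, hcr1, fun x y h => ?_⟩
  have := (isSMulRegular_quotient_iff_mem_of_smul_mem _ _).1 hdr x (by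
    have := sub_mem (Ideal.mem_sup_left h : _ ∈ I ⊔ Ideal.span {linearForm c}) (Ideal.mem_sup_right
      (Ideal.mul_mem_right y _ (Ideal.mem_span_singleton_self (linearForm c))))
    simpa using this)
  rw [sup_comm, Ideal.mem_span_singleton_sup] at this
  obtain ⟨t, b, hb, e⟩ := this
  exact ⟨-t, by rw [← e]; convert hb using 1; ring⟩

/-! ### Linear changes of coordinates -/

/-- The linear substitution `Xᵢ ↦ ∑ⱼ Aᵢⱼ Xⱼ`. -/
def linearSubst (A : Matrix (Fin 4) (Fin 4) ℂ) : S →ₐ[ℂ] S :=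
  MvPolynomial.aeval fun i => linearForm (A i)

theorem linearSubst_X (A : Matrix (Fin 4) (Fin 4) ℂ) (i : Fin 4) :
    linearSubst A (MvPolynomial.X i) = linearForm (A i) := by simp [linearSubst]

theorem linearSubst_isHomogeneous (A : Matrix (Fin 4) (Fin 4) ℂ) {n : ℕ} {f : S}
    (hf : f.IsHomogeneous n) : (linearSubst A f).IsHomogeneous n := by
  have := hf.aeval _ fun i => linearForm_isHomogeneous (A i)
  rwa [one_mul] at this

theorem linearSubst_comp (A B : Matrix (Fin 4) (Fin 4) ℂ) (h : B * A = 1) (f : S) :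
    linearSubst A (linearSubst B f) = f := by
  have : (linearSubst A).comp (linearSubst B) = AlgHom.id ℂ S := by
    ext i : 1
    rw [AlgHom.comp_apply, linearSubst_X, linearSubst, aeval_linearForm, AlgHom.id_apply,
      ← linearForm_single]
    have : (Pi.single i 1 : Fin 4 → ℂ) = ∑ j, B i j • A j := by
      ext k
      have := congrFun (congrFun h i) k
      rw [Matrix.mul_apply] at this
      simp [this, Matrix.one_apply, Pi.single_apply, eq_comm]
    rw [this]
    simp [Fin.sum_univ_four, linearForm_add, linearForm_smul, MvPolynomial.smul_eq_C_mul]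
  exact DFunLike.congr_fun this f

theorem eval_linearSubst (A : Matrix (Fin 4) (Fin 4) ℂ) (p : Fin 4 → ℂ) (f : S) :
    MvPolynomial.eval p (linearSubst A f) = MvPolynomial.eval (A.mulVec p) f := by
  have h : (MvPolynomial.aeval p).comp (linearSubst A) =
      MvPolynomial.aeval (R := ℂ) (A.mulVec p) := by
    ext i
    rw [AlgHom.comp_apply, linearSubst_X, MvPolynomial.aeval_X]
    exact eval_linearForm p (A i)
  simpa [MvPolynomial.coe_aeval_eq_eval] using DFunLike.congr_fun h f

/-- The linear substitution given by an invertible matrix. -/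
def linearEquiv (A B : Matrix (Fin 4) (Fin 4) ℂ) (h : B * A = 1) : S ≃ₐ[ℂ] S :=
  AlgEquiv.ofAlgHom (linearSubst A) (linearSubst B)
    (AlgHom.ext (linearSubst_comp A B h))
    (AlgHom.ext (linearSubst_comp B A (mul_eq_one_comm.1 h)))

theorem homogeneousComponent_linearEquiv (A B : Matrix (Fin 4) (Fin 4) ℂ) (h : B * A = 1)
    (n : ℕ) (f : S) : MvPolynomial.homogeneousComponent n (linearEquiv A B h f) =
      linearEquiv A B h (MvPolynomial.homogeneousComponent n f) :=
  homogeneousComponent_aeval _ (fun i => linearForm_isHomogeneous (A i)) n f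

theorem exists_eq_of_isHomogeneous_two {G : S} (hG : G.IsHomogeneous 2) :
    ∃ (a : ℂ) (p q : T), p.IsHomogeneous 1 ∧ q.IsHomogeneous 2 ∧
      G = MvPolynomial.C a * MvPolynomial.X 0 ^ 2 + incl p * MvPolynomial.X 0 + incl q := by
  set P := MvPolynomial.finSuccEquiv ℂ 3 G with hP
  have h2 := (MvPolynomial.totalDegree_zero_iff_isHomogeneous _).2
    (hG.finSuccEquiv_coeff_isHomogeneous 2 0 rfl)
  rw [MvPolynomial.totalDegree_eq_zero_iff_eq_C] at h2
  refine ⟨(P.coeff 2).coeff 0, P.coeff 1, P.coeff 0, hG.finSuccEquiv_coeff_isHomogeneous 1 1 rfl,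
    hG.finSuccEquiv_coeff_isHomogeneous 0 2 rfl,
    (MvPolynomial.finSuccEquiv ℂ 3).injective ?_⟩
  rw [map_add, map_add, map_mul, map_mul, map_pow, finSuccEquiv_incl, finSuccEquiv_incl,
    MvPolynomial.finSuccEquiv_X_zero, ← MvPolynomial.algebraMap_eq, AlgEquiv.commutes,
    IsScalarTower.algebraMap_apply ℂ T (Polynomial T), MvPolynomial.algebraMap_eq, ← h2]
  have hdeg : P.natDegree < 3 := by
    rw [hP, MvPolynomial.natDegree_finSuccEquiv]
    exact Nat.lt_succ_of_le ((MvPolynomial.degreeOf_le_totalDegree _ _).trans hG.totalDegree_le)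
  conv_lhs => rw [← hP, Polynomial.as_sum_range_C_mul_X_pow' P hdeg]
  simp [Finset.sum_range_succ, hP]
  ring

theorem IsDeterminantalWith.map {I : Ideal S} {Q : S} {k : ℕ} (h : IsDeterminantalWith I Q k)
    (σ : S ≃ₐ[ℂ] S) (hσ : ∀ n f, MvPolynomial.IsHomogeneous f n → (σ f).IsHomogeneous n) {a : ℂ}
    (ha : a ≠ 0) : IsDeterminantalWith (I.map σ) (MvPolynomial.C a * σ Q) k := by
  obtain ⟨e, L, r, he, hL, hr, rfl, hdet, he0, hLe, hsyz⟩ := h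
  have hunit : IsUnit (MvPolynomial.C a : S) := (IsUnit.mk0 a ha).map _
  have haa : (MvPolynomial.C a⁻¹ * MvPolynomial.C a : S) = 1 := by
    rw [← map_mul, inv_mul_cancel₀ ha, map_one]
  refine ⟨fun i => σ (e i), L.map σ, fun j => MvPolynomial.C a⁻¹ * σ (r j), fun i => hσ _ _ (he i),
    fun i j => hσ _ _ (hL i j), fun j => (hσ _ _ (hr j)).C_mul _, ?_, ?_, ?_, fun j => ?_,
    fun b hb => ?_⟩
  · rw [Ideal.map_span, Set.image_insert_eq, Set.image_pair, Ideal.span_insert,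
      Ideal.span_insert (_ * _), mul_comm, Ideal.span_singleton_mul_right_unit hunit]
  · rw [Matrix.det_fin_two] at hdet ⊢
    simpa using (map_ne_zero_iff σ σ.injective).2 hdet
  · exact (map_ne_zero_iff σ σ.injective).2 he0
  · have := congrArg σ (hLe j)
    simp only [map_add, map_mul] at this
    simp only [Matrix.map_apply]
    linear_combination this - σ (r j) * σ Q * haa
  · rw [mul_comm (MvPolynomial.C a), Ideal.span_singleton_mul_right_unit hunit,
      Ideal.mem_span_singleton] at hb
    obtain ⟨t, ht⟩ := hb
    obtain ⟨s, hs⟩ := hsyz (fun i => σ.symm (b i)) (Ideal.mem_span_singleton.2 ⟨σ.symm t, by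
      have := congrArg σ.symm ht
      simpa using this⟩)
    refine ⟨fun i => σ (s i), ?_⟩
    ext i : 1
    have := congrArg σ (congrFun hs i)
    simpa [Matrix.mulVec, dotProduct] using this

/-- Complete `c, d` to a basis of coordinates in which `p` lies on the first axis. Independence of
`c, d` comes from regularity: a linear relation would put a nonzero constant into the irrelevant
ideal. -/
theorem exists_matrix_of_regular {I : Ideal S} (hI0 : I ≤ irrelevantIdeal) {p c d : Fin 4 → ℂ}
    (hp : p ≠ 0) (hc : c ∈ vanishingAt p) (hd : d ∈ vanishingAt p)
    (hcr : ∀ x, linearForm c * x ∈ I → x ∈ I)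
    (hdr : ∀ x y, linearForm d * x + linearForm c * y ∈ I → ∃ z, x + linearForm c * z ∈ I) :
    ∃ (A B : Matrix (Fin 4) (Fin 4) ℂ), B * A = 1 ∧ A 1 = c ∧ A 2 = d ∧
      ∀ i : Fin 3, A.mulVec p i.succ = 0 := by
  have hC : ∀ t : ℂ, MvPolynomial.C t ∈ irrelevantIdeal → t = 0 := fun t ht => by
    simpa using mem_irrelevantIdeal_iff.1 ht
  have hcd : LinearIndependent ℂ ![(⟨c, hc⟩ : vanishingAt p), ⟨d, hd⟩] := by
    rw [LinearIndependent.pair_iff]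
    intro s t hst
    have hst : s • c + t • d = 0 := congrArg Subtype.val hst
    have hform := congrArg linearForm hst
    rw [linearForm_add, linearForm_smul, linearForm_smul, MvPolynomial.smul_eq_C_mul,
      MvPolynomial.smul_eq_C_mul, show linearForm 0 = 0 by simp [linearForm]] at hform
    have ht : t = 0 := by
      obtain ⟨z, hz⟩ := hdr (MvPolynomial.C t) (MvPolynomial.C s) (by
        rw [show linearForm d * MvPolynomial.C t + linearForm c * MvPolynomial.C s = 0 by
          linear_combination hform]
        exact zero_mem I)
      refine hC t ?_
      simpa using sub_mem (hI0 hz) (Ideal.mul_mem_right z _ (linearForm_mem_irrelevantIdeal c))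
    refine ⟨hC s (hI0 (hcr _ ?_)), ht⟩
    rw [ht, map_zero, zero_mul, add_zero, mul_comm] at hform
    rw [hform]
    exact zero_mem I
  obtain ⟨v, hv⟩ := exists_linearIndependent_snoc_of_lt_finrank hcd (finrank_vanishingAt p)
  have hv' := hv.map' (vanishingAt p).subtype (Submodule.ker_subtype _)
  obtain ⟨i, hi⟩ := Function.ne_iff.1 hp
  set A : Matrix (Fin 4) (Fin 4) ℂ := Matrix.of (Fin.cons (Pi.single i 1)
    ((vanishingAt p).subtype ∘ Fin.snoc ![(⟨c, hc⟩ : vanishingAt p), ⟨d, hd⟩] v)) with hA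
  have hrow : LinearIndependent ℂ A.row := by
    refine linearIndependent_finCons.2 ⟨hv', fun hmem => hi ?_⟩
    have : (Pi.single i 1 : Fin 4 → ℂ) ∈ vanishingAt p := by
      refine (Submodule.span_le.2 ?_) hmem
      rintro _ ⟨j, rfl⟩
      exact Subtype.property _
    have : (Pi.single i 1 : Fin 4 → ℂ) ⬝ᵥ p = 0 := this
    simpa using this
  refine ⟨A, A⁻¹, Matrix.nonsing_inv_mul A ((Matrix.isUnit_iff_isUnit_det A).1
    (Matrix.linearIndependent_rows_iff_isUnit.1 hrow)), rfl, rfl, fun j => ?_⟩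
  have : A j.succ ∈ vanishingAt p := Subtype.property _
  exact this

theorem exists_generators {F : S} (hF : IsSmoothQuadric F) {I : Ideal S}
    (hI : I.IsHomogeneous gradS) (hI0 : I ≤ irrelevantIdeal) (hFI : F ∈ I)
    (hne : ∃ g ∈ I, g ∉ Ideal.span {F}) {f g : S ⧸ I}
    (hf : f ∈ irrelevantIdeal.map (Ideal.Quotient.mk I))
    (hg : g ∈ irrelevantIdeal.map (Ideal.Quotient.mk I)) (hfg : IsRegular (S ⧸ I) [f, g]) :
    (∃ (G : S) (d : ℕ), G.IsHomogeneous d ∧ I = Ideal.span {F, G}) ∨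
      ∃ k, IsDeterminantalWith I F k := by
  obtain ⟨p, hp⟩ : ∃ p, MvPolynomial.eval p F ≠ 0 := by
    by_contra! h
    exact hF.ne_zero (MvPolynomial.funext fun x => by rw [h, map_zero])
  have hp0 : p ≠ 0 := by
    rintro rfl
    rw [MvPolynomial.eval_zero, MvPolynomial.constantCoeff_eq] at hp
    exact hp (hF.isHomogeneous.coeff_eq_zero (by simp))
  obtain ⟨c, hc, d, hd, hcr, hdr⟩ := exists_regular_linearForms hF.isHomogeneous hp hFI hf hg hfg
  obtain ⟨A, B, hBA, rfl, rfl, hAp⟩ := exists_matrix_of_regular hI0 hp0 hc hd hcr hdr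
  set σ := linearEquiv A B hBA with hσ
  have hσX : ∀ i, σ (MvPolynomial.X i) = linearForm (A i) := linearSubst_X A
  have hσhom : ∀ n f, MvPolynomial.IsHomogeneous f n → (σ f).IsHomogeneous n :=
    fun n f hf => linearSubst_isHomogeneous A hf
  have hσC : ∀ a, σ (MvPolynomial.C a) = MvPolynomial.C a := σ.commutes
  set I' := I.comap σ with hI'
  have hmap : I'.map σ = I := Ideal.map_comap_of_surjective σ σ.surjective I
  have hhom' : I'.IsHomogeneous gradS := by
    intro n x hx
    rw [hI', Ideal.mem_comap, show ((DirectSum.decompose gradS x n : gradS n) : S) = _ from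
      MvPolynomial.decomposition.decompose'_apply x n, ← homogeneousComponent_linearEquiv]
    have := hI n hx
    rwa [show ((DirectSum.decompose gradS (σ x) n : gradS n) : S) = _ from
      MvPolynomial.decomposition.decompose'_apply (σ x) n] at this
  have htop : I' ≠ ⊤ := Ideal.comap_ne_top σ fun h =>
    Ideal.IsPrime.ne_top (I := irrelevantIdeal) inferInstance (top_le_iff.1 (h ▸ hI0))
  obtain ⟨a, u, v, hu, hv, huv⟩ := exists_eq_of_isHomogeneous_two
    (G := σ.symm F) (linearSubst_isHomogeneous B hF.isHomogeneous)
  -- The coefficient of `X₀²` is, up to a nonzero factor, the value of `F` at `p`, which lies off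
  -- the quadric.
  have ha : a ≠ 0 := by
    rintro rfl
    have e := eval_linearSubst A p (σ.symm F)
    rw [show linearSubst A (σ.symm F) = F from σ.apply_symm_apply F, huv] at e
    have hz : A.mulVec p ∘ Fin.succ = 0 := funext hAp
    refine hp (e.trans ?_)
    have hu0 : u.coeff 0 = 0 := hu.coeff_eq_zero (by simp)
    have hv0 : v.coeff 0 = 0 := hv.coeff_eq_zero (by simp)
    simp only [map_add, map_mul, MvPolynomial.eval_rename, hz, MvPolynomial.eval_zero,
      MvPolynomial.constantCoeff_eq, hu0, hv0, map_zero, zero_mul, add_zero]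
  have haa : (MvPolynomial.C a * MvPolynomial.C a⁻¹ : S) = 1 := by
    rw [← map_mul, mul_inv_cancel₀ ha, map_one]
  set p' : T := - (MvPolynomial.C a⁻¹ * u) with hp'
  set q' : T := - (MvPolynomial.C a⁻¹ * v) with hq'
  have hFQ' : σ.symm F = MvPolynomial.C a * monicQuadric p' q' := by
    rw [huv, monicQuadric, hp', hq', map_neg, map_neg, map_mul, map_mul, MvPolynomial.rename_C]
    linear_combination (-(incl u * MvPolynomial.X 0) - incl v) * haa
  have hFQ : F = MvPolynomial.C a * σ (monicQuadric p' q') := by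
    rw [← hσC, ← map_mul, ← hFQ', AlgEquiv.apply_symm_apply]
  have hQF : σ (monicQuadric p' q') = MvPolynomial.C a⁻¹ * F := by
    rw [hFQ]; linear_combination -σ (monicQuadric p' q') * haa
  have key := exists_generators_of_monicQuadric (I := I') (p := p') (q := q') (hu.C_mul _).neg
    (hv.C_mul _).neg (fun s hs h0 => ?_) hhom' (le_irrelevantIdeal hhom' htop) ?_ ?_ ?_ ?_
  · rcases key with ⟨G, n, hG, hIG⟩ | ⟨k, hk⟩
    · refine Or.inl ⟨σ G, n, hσhom _ _ hG, ?_⟩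
      rw [← hmap, hIG, Ideal.map_span, Set.image_pair, Ideal.span_insert, Ideal.span_insert F, hFQ,
        mul_comm, Ideal.span_singleton_mul_right_unit ((IsUnit.mk0 a ha).map _)]
    · refine Or.inr ⟨k, ?_⟩
      rw [← hmap, hFQ]
      exact hk.map σ hσhom ha
  · have hlin : ∀ t : T, t.IsHomogeneous 1 →
        (σ (MvPolynomial.X 0 - incl t)).IsHomogeneous 1 := fun t ht =>
      hσhom _ _ ((MvPolynomial.isHomogeneous_X ℂ 0).sub ht.rename_isHomogeneous)
    -- The roots of `X₀² - p'X₀ - q'` sum to `p'`, so the second linear factor is `X₀ - (p' - s)`.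
    refine hF.ne_mul ((hlin s hs).C_mul a) (hlin (p' - s) ((hu.C_mul _).neg.sub hs)) ?_
    rw [hFQ, mul_assoc, ← map_mul]
    congr 2
    have := congrArg incl h0
    simp only [map_sub, map_mul, map_pow, map_zero] at this
    rw [monicQuadric, map_sub]
    linear_combination this
  · rw [hI', Ideal.mem_comap, hQF]
    exact I.mul_mem_left _ hFI
  · obtain ⟨x, hx, hxF⟩ := hne
    refine ⟨σ.symm x, by rwa [hI', Ideal.mem_comap, AlgEquiv.apply_symm_apply], fun h => hxF ?_⟩
    obtain ⟨t, ht⟩ := Ideal.mem_span_singleton.1 h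
    have := congrArg σ ht
    rw [AlgEquiv.apply_symm_apply, map_mul, hQF] at this
    exact Ideal.mem_span_singleton.2 ⟨MvPolynomial.C a⁻¹ * σ t, by rw [this]; ring⟩
  · intro x hx
    rw [hI', Ideal.mem_comap, map_mul, hσX] at hx
    exact hcr _ hx
  · intro x y hxy
    rw [hI', Ideal.mem_comap, map_add, map_mul, map_mul, hσX, hσX] at hxy
    obtain ⟨z, hz⟩ := hdr _ _ hxy
    refine ⟨σ.symm z, ?_⟩
    rwa [hI', Ideal.mem_comap, map_add, map_mul, hσX, AlgEquiv.apply_symm_apply]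

/-! ### From generators to resolutions -/

theorem isRegular_pair_of_prime {F G : S} (hF : Prime F) (hG : G ∉ Ideal.span {F})
    (h : Ideal.span {F, G} ≠ ⊤) : IsRegular S [F, G] := by
  refine isRegular_pair_iff.2 ⟨fun x hx => (mul_eq_zero.1 hx).resolve_left hF.ne_zero,
    fun x hx => (hF.dvd_or_dvd hx).resolve_left fun h => hG (Ideal.mem_span_singleton.2 h), h⟩

theorem IsHomogeneousElt.eq_zero_or_exists {b d : ℕ} {v : Fin 2 → S}
    (h : IsHomogeneousElt ![b, b] d v) :
    v = 0 ∨ ∃ n, n + b = d ∧ ∀ i, (v i).IsHomogeneous n := by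
  have hb : ∀ i : Fin 2, (![b, b] : Fin 2 → ℕ) i = b := fun i => by fin_cases i <;> rfl
  by_cases hd : b ≤ d
  · refine Or.inr ⟨d - b, by omega, fun i => ?_⟩
    rcases h i with ⟨n, hn, hv⟩ | hv
    · rw [hb] at hn
      rwa [show d - b = n by omega]
    · rw [hv]
      exact MvPolynomial.isHomogeneous_zero _ _ _
  · left
    ext i : 1
    rcases h i with ⟨n, hn, hv⟩ | hv
    · rw [hb] at hn
      omega
    · exact hv

theorem IsHomogeneousElt.mul_isHomogeneous {n : ℕ} {a : Fin n → ℕ} {d : ℕ} {v : Fin n → S}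
    (h : IsHomogeneousElt a d v) (i : Fin n) {w : S} (hw : w.IsHomogeneous (a i)) :
    (v i * w).IsHomogeneous d := by
  rcases h i with ⟨e, rfl, hv⟩ | hv
  · exact hv.mul hw
  · rw [hv, zero_mul]
    exact MvPolynomial.isHomogeneous_zero _ _ _

theorem mem_irrelevantIdeal_of_isHomogeneous {f : S} {n : ℕ} (hf : f.IsHomogeneous n) (hn : n ≠ 0) :
    f ∈ irrelevantIdeal :=
  mem_irrelevantIdeal_iff.2 (hf.coeff_eq_zero (by simpa using hn.symm))

/-- The Hilbert–Burch matrix is `L` with the row `-r` below it. Injectivity needs only `det L ≠ 0`;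
in exactness the third coordinate is recovered by cancelling `F`. The bound `1 ≤ k` is what makes
the entries of `r` nonconstant or zero, hence the resolution minimal. -/
theorem IsDeterminantalWith.hasMinimalFreeResolution {I : Ideal S} {F : S} {k : ℕ}
    (h : IsDeterminantalWith I F k) (hF : F.IsHomogeneous 2) (hF0 : F ≠ 0) (hk : 1 ≤ k) :
    HasMinimalFreeResolution I ![2 + k, 2 + k] ![1 + k, 1 + k, 2] := by
  obtain ⟨e, L, r, he, hL, hr, rfl, hdet, -, hLe, hsyz⟩ := h
  set M : Matrix (Fin 3) (Fin 2) S := !![L 0 0, L 0 1; L 1 0, L 1 1; -r 0, -r 1] with hM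
  have hφ : ∀ s, M.mulVecLin s = ![L 0 0 * s 0 + L 0 1 * s 1, L 1 0 * s 0 + L 1 1 * s 1,
      -r 0 * s 0 + -r 1 * s 1] := fun s => by
    ext i : 1
    fin_cases i <;> simp [hM, Matrix.mulVec, dotProduct]
  have hψ : ∀ x, Fintype.linearCombination S ![e 0, e 1, F] x =
      x 0 * e 0 + x 1 * e 1 + x 2 * F := fun x => by
    simp [Fintype.linearCombination_apply, Fin.sum_univ_three]
  refine ⟨M.mulVecLin, Fintype.linearCombination S ![e 0, e 1, F], fun d v hv => ?_,
    fun d v hv => ?_, ?_, fun x => ⟨fun hx => ?_, ?_⟩, ?_, fun v i => ?_⟩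
  · rcases hv.eq_zero_or_exists with rfl | ⟨n, rfl, hvn⟩
    · intro i
      right
      rw [map_zero]
      rfl
    · intro i
      left
      rw [hφ]
      fin_cases i
      · exact ⟨1 + n, by simp; omega, ((hL 0 0).mul (hvn 0)).add ((hL 0 1).mul (hvn 1))⟩
      · exact ⟨1 + n, by simp; omega, ((hL 1 0).mul (hvn 0)).add ((hL 1 1).mul (hvn 1))⟩
      · exact ⟨k + n, by simp; omega, ((hr 0).neg.mul (hvn 0)).add ((hr 1).neg.mul (hvn 1))⟩
  · rw [hψ]
    refine ((hv.mul_isHomogeneous 0 ?_).add (hv.mul_isHomogeneous 1 ?_)).add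
      (hv.mul_isHomogeneous 2 hF)
    · simpa [add_comm] using he 0
    · simpa [add_comm] using he 1
  · refine (injective_iff_map_eq_zero _).2 fun s hs => Matrix.eq_zero_of_mulVec_eq_zero hdet ?_
    rw [hφ] at hs
    ext i : 1
    fin_cases i
    · simpa [Matrix.mulVec, dotProduct] using congrFun hs 0
    · simpa [Matrix.mulVec, dotProduct] using congrFun hs 1
  · rw [hψ] at hx
    obtain ⟨s, hs⟩ := hsyz ![x 0, x 1] (Ideal.mem_span_singleton.2 ⟨-x 2, by
      simp; linear_combination hx⟩)
    have h0 : x 0 = L 0 0 * s 0 + L 0 1 * s 1 := by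
      simpa [Matrix.mulVec, dotProduct] using congrFun hs 0
    have h1 : x 1 = L 1 0 * s 0 + L 1 1 * s 1 := by
      simpa [Matrix.mulVec, dotProduct] using congrFun hs 1
    refine ⟨s, ?_⟩
    rw [hφ]
    ext i : 1
    fin_cases i
    · exact h0.symm
    · exact h1.symm
    · refine mul_right_cancel₀ hF0 ?_
      show (-r 0 * s 0 + -r 1 * s 1) * F = x 2 * F
      linear_combination e 0 * h0 + e 1 * h1 - hx + s 0 * hLe 0 + s 1 * hLe 1
  · rintro ⟨s, rfl⟩
    rw [hψ, hφ]
    simp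
    linear_combination s 0 * hLe 0 + s 1 * hLe 1
  · rw [Fintype.range_linearCombination]
    congr 1
    ext x
    simp
    tauto
  · rw [hφ]
    have hLm : ∀ i j, L i j ∈ irrelevantIdeal := fun i j =>
      mem_irrelevantIdeal_of_isHomogeneous (hL i j) one_ne_zero
    have hrm : ∀ j, -r j ∈ irrelevantIdeal := fun j =>
      neg_mem (mem_irrelevantIdeal_of_isHomogeneous (hr j) (by omega))
    fin_cases i
    · exact add_mem (Ideal.mul_mem_right _ _ (hLm 0 0)) (Ideal.mul_mem_right _ _ (hLm 0 1))
    · exact add_mem (Ideal.mul_mem_right _ _ (hLm 1 0)) (Ideal.mul_mem_right _ _ (hLm 1 1))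
    · exact add_mem (Ideal.mul_mem_right _ _ (hrm 0)) (Ideal.mul_mem_right _ _ (hrm 1))

theorem eq_C_of_isHomogeneous_zero {f : S} (hf : f.IsHomogeneous 0) : ∃ c, f = MvPolynomial.C c :=
  ⟨_, MvPolynomial.totalDegree_eq_zero_iff_eq_C.1
    ((MvPolynomial.totalDegree_zero_iff_isHomogeneous _).2 hf)⟩

/-- For `k = 0` the row `r` consists of constants, so `F` is redundant; eliminating it leaves a
single syzygy between the two linear forms, which must be the Koszul one. -/
theorem IsDeterminantalWith.exists_isRegular_pair {I : Ideal S} {F : S}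
    (h : IsDeterminantalWith I F 0) (hF0 : F ≠ 0) (hI : I ≠ ⊤) :
    ∃ e₁ e₂ : S, e₁.IsHomogeneous 1 ∧ e₂.IsHomogeneous 1 ∧ IsRegular S [e₁, e₂] ∧
      I = Ideal.span {e₁, e₂} := by
  obtain ⟨e, L, r, he, hL, hr, rfl, hdet, he0, hLe, hsyz⟩ := h
  obtain ⟨c₀, hc₀⟩ := eq_C_of_isHomogeneous_zero (hr 0)
  obtain ⟨c₁, hc₁⟩ := eq_C_of_isHomogeneous_zero (hr 1)
  have hl0 := hLe 0
  have hl1 := hLe 1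
  rw [hc₀] at hl0
  rw [hc₁] at hl1
  have hinv : ∀ c : ℂ, c ≠ 0 → (MvPolynomial.C c⁻¹ * MvPolynomial.C c : S) = 1 := fun c hc => by
    rw [← map_mul, inv_mul_cancel₀ hc, map_one]
  -- If both constants were zero, Cramer's rule would give `det L * e 0 = 0`.
  have hc : c₀ ≠ 0 ∨ c₁ ≠ 0 := by
    by_contra! hc
    rw [hc.1, map_zero, zero_mul] at hl0
    rw [hc.2, map_zero, zero_mul] at hl1
    refine (mul_ne_zero hdet he0) ?_
    rw [Matrix.det_fin_two]
    linear_combination L 1 1 * hl0 - L 1 0 * hl1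
  have hFe : F ∈ Ideal.span {e 0, e 1} := by
    rw [Ideal.mem_span_pair]
    rcases hc with hc | hc
    · exact ⟨MvPolynomial.C c₀⁻¹ * L 0 0, MvPolynomial.C c₀⁻¹ * L 1 0, by
        linear_combination MvPolynomial.C c₀⁻¹ * hl0 + F * hinv _ hc⟩
    · exact ⟨MvPolynomial.C c₁⁻¹ * L 0 1, MvPolynomial.C c₁⁻¹ * L 1 1, by
        linear_combination MvPolynomial.C c₁⁻¹ * hl1 + F * hinv _ hc⟩
  have hspan : Ideal.span {F, e 0, e 1} = Ideal.span {e 0, e 1} := by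
    rw [Ideal.span_insert]
    exact sup_eq_right.2 ((Ideal.span_singleton_le_iff_mem _).2 hFe)
  rw [hspan] at hI ⊢
  set w : S := MvPolynomial.C c₀ * L 1 1 - MvPolynomial.C c₁ * L 1 0 with hw
  -- The syzygies of the two linear forms are the multiples of a single one.
  have hmul : ∀ x y : S, x * e 1 = y * e 0 → w ∣ x := by
    intro x y hxy
    obtain ⟨s, hs⟩ := hsyz ![-y, x] (by simp [hxy])
    have h0 : -y = L 0 0 * s 0 + L 0 1 * s 1 := by
      simpa [Matrix.mulVec, dotProduct] using congrFun hs 0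
    have h1 : x = L 1 0 * s 0 + L 1 1 * s 1 := by
      simpa [Matrix.mulVec, dotProduct] using congrFun hs 1
    have hrel : MvPolynomial.C c₀ * s 0 + MvPolynomial.C c₁ * s 1 = 0 := by
      refine (mul_eq_zero.1 (?_ : _ * F = 0)).resolve_right hF0
      linear_combination hxy - e 0 * h0 - e 1 * h1 - s 0 * hl0 - s 1 * hl1
    rcases hc with hc | hc
    · exact ⟨MvPolynomial.C c₀⁻¹ * s 1, by
        linear_combination h1 + MvPolynomial.C c₀⁻¹ * L 1 0 * hrel -
          (L 1 0 * s 0 + L 1 1 * s 1) * hinv _ hc⟩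
    · exact ⟨-MvPolynomial.C c₁⁻¹ * s 0, by
        linear_combination h1 + MvPolynomial.C c₁⁻¹ * L 1 1 * hrel -
          (L 1 0 * s 0 + L 1 1 * s 1) * hinv _ hc⟩
  -- Applied to the Koszul syzygy this gives `w ∣ e 0`; both are linear, so they agree up to a unit.
  obtain ⟨t, ht⟩ := hmul (e 0) (e 1) (mul_comm _ _)
  have hw1 : w.IsHomogeneous 1 := ((hL 1 1).C_mul c₀).sub ((hL 1 0).C_mul c₁)
  have hw0 : w ≠ 0 := by rintro h; rw [h, zero_mul] at ht; exact he0 ht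
  have ht0 : t ≠ 0 := by rintro rfl; rw [mul_zero] at ht; exact he0 ht
  have htd : t.totalDegree = 0 := by
    have := congrArg MvPolynomial.totalDegree ht
    rw [MvPolynomial.totalDegree_mul_of_isDomain hw0 ht0, (he 0).totalDegree he0,
      hw1.totalDegree hw0] at this
    omega
  have htu : IsUnit t := by
    rw [MvPolynomial.totalDegree_eq_zero_iff_eq_C] at htd
    rw [htd] at ht0 ⊢
    exact (IsUnit.mk0 _ fun h0 => ht0 (by rw [h0, map_zero])).map _
  refine ⟨e 0, e 1, he 0, he 1, isRegular_pair_iff.2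
    ⟨fun x hx => (mul_eq_zero.1 hx).resolve_left he0, fun x hx => ?_, hI⟩, rfl⟩
  obtain ⟨y, hy⟩ := hx
  rw [ht, htu.mul_right_dvd]
  exact hmul x y (by linear_combination hy)

/-! ### Curves on a smooth quadric -/

/-- The supremum defining the depth exceeds 1, so some regular sequence has length at least two; its
first two members are regular. -/
theorem exists_isRegular_pair_of_one_lt_depth {R : Type*} [CommRing R] {P : Ideal R}
    (h : 1 < depth P) : ∃ f ∈ P, ∃ g ∈ P, IsRegular R [f, g] := by
  obtain ⟨⟨rs, hrs, hP⟩, hlen⟩ := lt_iSup_iff.1 h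
  match rs, hrs, hP, hlen with
  | [], _, _, hlen => simp at hlen
  | [_], _, _, hlen => simp at hlen
  | f :: g :: t, hrs, hP, _ =>
    refine ⟨f, hP f (by simp), g, hP g (by simp),
      ((isWeaklyRegular_append_iff R [f, g] t).1 hrs.toIsWeaklyRegular).1, fun htop => ?_⟩
    refine hrs.top_ne_smul (top_le_iff.1 (htop.le.trans ?_)).symm
    rw [show f :: g :: t = [f, g] ++ t from rfl, Ideal.ofList_append]
    exact Submodule.smul_mono_left le_sup_left

theorem homogeneousIdeal_le_irrelevantIdeal {C : Scheme} {ι : C ⟶ P3} (hC : IsCurve ι) :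
    homogeneousIdeal ι ≤ irrelevantIdeal := by
  obtain ⟨x, -, hx, -⟩ := exists_lt_of_isCurve hC
  refine le_irrelevantIdeal (homogeneousIdeal_isHomogeneous ι) fun h => ?_
  exact Ideal.IsPrime.ne_top (I := pointIdeal x) inferInstance (top_le_iff.1 (h ▸ hx))

theorem IsACM.exists_isRegular_pair {C : Scheme} {ι : C ⟶ P3} (hC : IsCurve ι) (h : IsACM ι) :
    ∃ f ∈ irrelevantIdeal.map (Ideal.Quotient.mk (homogeneousIdeal ι)),
      ∃ g ∈ irrelevantIdeal.map (Ideal.Quotient.mk (homogeneousIdeal ι)),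
        IsRegular (S ⧸ homogeneousIdeal ι) [f, g] := by
  have hmax := Ideal.IsMaximal.map_of_surjective_of_ker_le
    (Ideal.Quotient.mk_surjective (I := homogeneousIdeal ι)) (m := irrelevantIdeal)
    (by rw [Ideal.mk_ker]; exact homogeneousIdeal_le_irrelevantIdeal hC)
  refine exists_isRegular_pair_of_one_lt_depth ?_
  rw [h.2 _ hmax]
  exact lt_of_lt_of_le (by norm_num) (two_le_height hC)

theorem isACM_of_resolution {F : S} (hF : IsSmoothQuadric F) {C : Scheme} {ι : C ⟶ P3}
    (hC : IsCurve ι) (hCF : IsContainedIn ι F) {m n : ℕ} {φ : (Fin m → S) →ₗ[S] (Fin n → S)}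
    {ψ : (Fin n → S) →ₗ[S] S} (hφ : Function.Injective φ) (hex : Function.Exact φ ψ)
    (hI : LinearMap.range ψ = homogeneousIdeal ι) : IsACM ι := by
  obtain ⟨g, hg, hgF⟩ := exists_mem_notMem_span_of_isCurve hF hC
  exact isCohenMacaulay_of_resolution hφ hex hI (ringKrullDim_quotient_le_two hF.prime hCF hg hgF)

theorem isACM_iff {F : S} (hF : IsSmoothQuadric F) {C : Scheme} {ι : C ⟶ P3} (hC : IsCurve ι)
    (hCF : IsContainedIn ι F) :
    IsACM ι ↔ (IsCompleteIntersection ι ∨ ∃ k : ℕ, 1 ≤ k ∧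
      HasMinimalFreeResolution (homogeneousIdeal ι) ![2 + k, 2 + k] ![1 + k, 1 + k, 2]) := by
  refine ⟨fun h => ?_, ?_⟩
  · obtain ⟨f, hf, g, hg, hfg⟩ := h.exists_isRegular_pair hC
    have hle := homogeneousIdeal_le_irrelevantIdeal hC
    have htop : homogeneousIdeal ι ≠ ⊤ := fun h =>
      Ideal.IsPrime.ne_top (I := irrelevantIdeal) inferInstance (top_le_iff.1 (h ▸ hle))
    obtain ⟨x, hx, hxF⟩ := exists_mem_notMem_span_of_isCurve hF hC
    rcases exists_generators hF (homogeneousIdeal_isHomogeneous ι) hle hCF ⟨x, hx, hxF⟩ hf hg hfg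
      with ⟨G, d, hG, hI⟩ | ⟨k, hk⟩
    · refine Or.inl ⟨F, G, 2, d, hF.isHomogeneous, hG,
        isRegular_pair_of_prime hF.prime (fun hGF => hxF ?_) (hI ▸ htop), hI⟩
      rwa [hI, Ideal.span_insert, sup_eq_left.2 ((Ideal.span_singleton_le_iff_mem _).2 hGF)] at hx
    · rcases Nat.eq_zero_or_pos k with rfl | hk0
      · obtain ⟨e₁, e₂, h₁, h₂, hreg, hI⟩ := hk.exists_isRegular_pair hF.ne_zero htop
        exact Or.inl ⟨e₁, e₂, 1, 1, h₁, h₂, hreg, hI⟩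
      · exact Or.inr ⟨k, hk0, hk.hasMinimalFreeResolution hF.isHomogeneous hF.ne_zero hk0⟩
  · rintro (⟨G, H, -, -, -, -, hreg, hI⟩ | ⟨k, -, φ, ψ, -, -, hφ, hex, hI, -⟩)
    · obtain ⟨φ, ψ, hφ, hex, hrange⟩ := exists_resolution_of_isRegular_pair hreg
      exact isACM_of_resolution hF hC hCF hφ hex (hrange.trans hI.symm)
    · exact isACM_of_resolution hF hC hCF hφ hex hI

end SpaceCurves

end

theorem mainTheorem12 (F : SpaceCurves.S) (hF : SpaceCurves.IsSmoothQuadric F)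
    (C : Scheme) (ι : C ⟶ SpaceCurves.P3) (hC : SpaceCurves.IsCurve ι)
    (hCF : SpaceCurves.IsContainedIn ι F) :
    SpaceCurves.IsACM ι ↔
      (SpaceCurves.IsCompleteIntersection ι ∨
        ∃ k : ℕ, 1 ≤ k ∧
          SpaceCurves.HasMinimalFreeResolution (SpaceCurves.homogeneousIdeal ι)
            ![2 + k, 2 + k] ![1 + k, 1 + k, 2]) :=
  SpaceCurves.isACM_iff hF hC hCF
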